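/- Let $g:\mathbb{R}\to\mathbb{R}$ be Lipschitz continuous (not necessarily bounded). For $\varepsilon\in(0,1)$ let $u^\varepsilon$ be the viscosity solution of $$u^\varepsilon_t+\tfrac12|u^\varepsilon_x|^2=\varepsilon u^\varepsilon_{xx}\ \text{ in } \mathbb{R}\times(0,\infty),\qquad u^\varepsilon(x,0)=g(x)\ \text{ on } \mathbb{R},$$ and let $u$ be the viscosity solution of $$u_t+\tfrac12|u_x|^2=0\ \text{ in } \mathbb{R}\times(0,\infty),\qquad u(x,0)=g(x)\ \text{ on } \mathbb{R}.$$ Here viscosity solutions are continuous on $\mathbb{R}\times[0,\infty)$ and, as usual for Lipschitz data, of at most linear growth in $x$, uniformly for $t$ in bounded intervals. Then the following hold. (i) For each fixed $(x,t)\in\mathbb{R}\times[0,\infty)$ there is $\varepsilon_0=\varepsilon_0(x,t)\in(0,1]$ such that $|u^\varepsilon(x,t)-u(x,t)|\le 2\varepsilon|\log\varepsilon|$ for all $\varepsilon\in(0,\varepsilon_0)$. (ii) If in addition $g\in C^2(\mathbb{R})$, then for each fixed $t>0$ and for a.e. $x\in\mathbb{R}$ there is a constant $C=C(x,t)>0$,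 independent of $\varepsilon$, such that $|u^\varepsilon(x,t)-u(x,t)|\le C\varepsilon$ for all $\varepsilon\in(0,1)$. (iii) If $g(x)=-\tfrac12x^2$ for all $x\in[-1,1]$ and $g(x)\ge-\tfrac12x^2$ for all $x\in\mathbb{R}$, then there is $\varepsilon_0\in(0,1]$ such that $|u^\varepsilon(0,1)-u(0,1)|\ge\tfrac12\varepsilon|\log\varepsilon|$ for all $\varepsilon\in(0,\varepsilon_0)$. -/

import Mathlib

open Filter Topology MeasureTheory
open scoped NNReal

/-- Viscosity subsolution of `u_t + F(u_x) = ε u_xx` in `ℝ × (0, ∞)` (arguments: `u x t`):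
the subsolution inequality holds at every point `(x₀, t₀)` with `t₀ > 0` for every function `φ` that
is `C²` near `(x₀, t₀)` and for which `u - φ` has a local maximum there.
For `ε = 0` this is the first-order notion. -/
def IsViscositySubsolution (F : ℝ → ℝ) (ε : ℝ) (u : ℝ → ℝ → ℝ) : Prop :=
  ∀ (φ : ℝ → ℝ → ℝ) (x₀ t₀ : ℝ), 0 < t₀ →
    ContDiffAt ℝ 2 (fun z : ℝ × ℝ => φ z.1 z.2) (x₀, t₀) →
    IsLocalMax (fun z : ℝ × ℝ => u z.1 z.2 - φ z.1 z.2) (x₀, t₀) →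
    deriv (fun t => φ x₀ t) t₀ + F (deriv (fun x => φ x t₀) x₀)
      ≤ ε * iteratedDeriv 2 (fun x => φ x t₀) x₀

/-- Viscosity supersolution of `u_t + F(u_x) = ε u_xx` in `ℝ × (0, ∞)`: the reverse inequality holds
whenever `u - φ` has a local minimum at `(x₀, t₀)`. -/
def IsViscositySupersolution (F : ℝ → ℝ) (ε : ℝ) (u : ℝ → ℝ → ℝ) : Prop :=
  ∀ (φ : ℝ → ℝ → ℝ) (x₀ t₀ : ℝ), 0 < t₀ →
    ContDiffAt ℝ 2 (fun z : ℝ × ℝ => φ z.1 z.2) (x₀, t₀) →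
    IsLocalMin (fun z : ℝ × ℝ => u z.1 z.2 - φ z.1 z.2) (x₀, t₀) →
    ε * iteratedDeriv 2 (fun x => φ x t₀) x₀
      ≤ deriv (fun t => φ x₀ t) t₀ + F (deriv (fun x => φ x t₀) x₀)

/-- `u` is the viscosity solution of the Cauchy problem
`u_t + F(u_x) = ε u_xx` in `ℝ × (0, ∞)`, `u(x, 0) = g(x)` on `ℝ`:
it is continuous on `ℝ × [0, ∞)`, is both a sub- and a supersolution, attains the initial datum, and
belongs to the usual uniqueness class for Lipschitz data, the functions that grow at most linearly
in `x`, uniformly for `t` in bounded intervals. Values at negative times play no role. -/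
structure IsViscositySolution (F : ℝ → ℝ) (ε : ℝ) (g : ℝ → ℝ) (u : ℝ → ℝ → ℝ) : Prop where
  continuousOn : ContinuousOn (fun z : ℝ × ℝ => u z.1 z.2) (Set.univ ×ˢ Set.Ici 0)
  subsolution : IsViscositySubsolution F ε u
  supersolution : IsViscositySupersolution F ε u
  initial : ∀ x, u x 0 = g x
  linear_growth : ∀ T : ℝ, 0 < T → ∃ C : ℝ, ∀ x : ℝ, ∀ t ∈ Set.Icc 0 T, |u x t| ≤ C * (1 + |x|)

/-! For positive times both solutions have explicit formulas. The viscous solution is the Cole–Hopf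
integral and the inviscid one is the minimum over `y` of the Hopf–Lax cost `(x - y)² / (2t) + g y`.
Hence their difference is `ε log(4πεt) - 2ε log I`, where `I` is the integral of `exp(-(cost - min)
/ (2ε))`, and everything reduces to Laplace's method for `I`.

For merely Lipschitz `g`, the cost rises by `O(ε)` within distance `ε` of a minimizer, so `I ≥ cε`;
and `I` is bounded by its value at `ε = 1`. This gives an error `ε |log ε| + O(ε)`. For `C²` data,
`I` has order exactly `√ε` once all minimizers are nondegenerate, and the logarithms cancel. A
degenerate minimizer makes `x` a critical value of `y ↦ y + t g'(y)`, and these values form a null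
set by Sard. In (iii) the cost vanishes on `[-1, 1]`, so `I ≥ 2` and the logarithm survives.

The formulas are identified without comparing two viscosity solutions: comparison with smooth sub-
and supersolutions suffices (`subsolution_le`, `le_supersolution`). The viscous solution is squeezed
between small time shifts of Cole–Hopf, moved by `±κ`. The inviscid one lies below the explicit
solutions issuing from parabolas. It lies above Cole–Hopf minus a correction: semiconcavity bounds
the viscous term by `ε / t`, which integrates to a multiple of `ε` times a logarithm, so Cole–Hopf
becomes a classical inviscid subsolution (`IsViscositySolution.coleHopf_le`). -/

/-! ### Comparison of viscosity solutions with smooth functions. -/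

/-- Coercive penalization: a function that is positive somewhere, nonpositive at the initial time and
of linear growth from above has an interior local maximum after subtraction of a small multiple of
`(1 + x²) e^{Lt} + 1 / (T - t)`. -/
theorem exists_penalized_isLocalMax {D : ℝ → ℝ → ℝ} {T C L η : ℝ}
    (hD : ContinuousOn (fun z : ℝ × ℝ => D z.1 z.2) (Set.univ ×ˢ Set.Ici 0))
    (hgrowth : ∀ x, ∀ t ∈ Set.Icc 0 T, D x t ≤ C * (1 + |x|))
    (h0 : ∀ x, D x 0 ≤ 0) {x₁ t₁ : ℝ} (ht₁ : 0 ≤ t₁) (ht₁T : t₁ < T) (hpos : 0 < D x₁ t₁)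
    (hL : 0 ≤ L) (hη : 0 < η) :
    ∃ δ, 0 < δ ∧ δ ≤ η ∧ ∃ x₀ t₀, 0 < t₀ ∧ t₀ < T ∧
      IsLocalMax (fun z : ℝ × ℝ =>
        D z.1 z.2 - δ * ((1 + z.1 ^ 2) * Real.exp (L * z.2) + (T - z.2)⁻¹)) (x₀, t₀) := by
  wlog hC : 0 ≤ C generalizing C
  · refine this (C := |C|) (fun x t ht => (hgrowth x t ht).trans ?_) (abs_nonneg C)
    exact mul_le_mul_of_nonneg_right (le_abs_self C) (by positivity)
  have hT : 0 < T := ht₁.trans_lt ht₁T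
  set ψ : ℝ → ℝ → ℝ := fun x t => (1 + x ^ 2) * Real.exp (L * t) + (T - t)⁻¹ with hψ
  have hψpos : ∀ x t, t < T → 0 < ψ x t := by
    intro x t ht
    have : 0 < T - t := by linarith
    simp only [hψ]; positivity
  have hψ1 := hψpos x₁ t₁ ht₁T
  -- The second bound makes the penalty at `(x₁, t₁)` at most half of `D x₁ t₁`, so `f` stays
  -- positive there.
  set δ := min η (D x₁ t₁ / (2 * ψ x₁ t₁)) with hδ
  have hδpos : 0 < δ := by simp only [hδ]; positivity
  refine ⟨δ, hδpos, min_le_left _ _, ?_⟩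
  set f : ℝ × ℝ → ℝ := fun z => D z.1 z.2 - δ * ψ z.1 z.2 with hf
  have hf1 : 0 < f (x₁, t₁) := by
    have : δ * ψ x₁ t₁ ≤ D x₁ t₁ / (2 * ψ x₁ t₁) * ψ x₁ t₁ :=
      mul_le_mul_of_nonneg_right (min_le_right _ _) hψ1.le
    have h2 : D x₁ t₁ / (2 * ψ x₁ t₁) * ψ x₁ t₁ = D x₁ t₁ / 2 := by field_simp
    simp only [hf]; linarith
  -- Beyond `R` the term `δ x²` beats the linear growth of `D`; within `s` of time `T` the term `δ /
  -- (T - t)` beats `C (1 + R)`. So `f > 0` only in a compact region away from `T`.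
  set R := 2 * C / δ + 1 with hR
  set s := min (T / 2) (δ / (C * (1 + R) + 1)) with hs
  have hRpos : 0 < R := by positivity
  have hspos : 0 < s := by simp only [hs]; positivity
  have hsT : s ≤ T / 2 := min_le_left _ _
  have hR1 : 2 * C / δ + 1 ≤ R := le_rfl
  have hsδ : s ≤ δ / (C * (1 + R) + 1) := min_le_right _ _
  clear_value R s δ
  have key : ∀ x t, 0 ≤ t → t < T → 0 < f (x, t) → |x| < R ∧ 0 < t ∧ t < T - s := by
    intro x t ht htT hfx
    have hDx := hgrowth x t ⟨ht, htT.le⟩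
    have hTt : 0 < T - t := by linarith
    have hinv : 0 < (T - t)⁻¹ := by positivity
    have hexp : 1 ≤ Real.exp (L * t) := Real.one_le_exp (by positivity)
    have hsq : 1 + x ^ 2 ≤ (1 + x ^ 2) * Real.exp (L * t) :=
      le_mul_of_one_le_right (by positivity) hexp
    have hfx' : δ * ((1 + x ^ 2) * Real.exp (L * t) + (T - t)⁻¹) < D x t := by
      simpa [hf, hψ] using hfx
    have hxR : |x| < R := by
      by_contra! hx
      have h1 : δ * (1 + x ^ 2) < C * (1 + |x|) := by
        refine lt_of_lt_of_le ?_ hDx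
        refine lt_of_le_of_lt (mul_le_mul_of_nonneg_left ?_ hδpos.le) hfx'
        linarith
      have h2 : 2 * C ≤ δ * |x| := by
        have : 2 * C / δ ≤ |x| := (le_add_of_nonneg_right zero_le_one).trans (hR1.trans hx)
        rw [div_le_iff₀ hδpos] at this
        linarith
      have h3 : 1 ≤ |x| := (le_add_of_nonneg_left (by positivity)).trans (hR1.trans hx)
      rw [← sq_abs] at h1
      nlinarith
    refine ⟨hxR, lt_of_le_of_ne ht ?_, ?_⟩
    · rintro rfl
      have := h0 x
      have : 0 < δ * ((1 + x ^ 2) * Real.exp (L * 0) + (T - 0)⁻¹) := by positivity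
      linarith
    · by_contra! hx
      have h1 : T - t ≤ δ / (C * (1 + R) + 1) := le_trans (by linarith only [hx]) hsδ
      have h2 : C * (1 + R) + 1 ≤ δ * (T - t)⁻¹ := by
        rw [le_div_iff₀ (by positivity)] at h1
        rw [← div_eq_mul_inv, le_div_iff₀ hTt]; linarith only [h1]
      have h3 : C * (1 + |x|) ≤ C * (1 + R) := by gcongr
      have h4 : δ * (T - t)⁻¹ ≤ δ * ((1 + x ^ 2) * Real.exp (L * t) + (T - t)⁻¹) := by
        gcongr; linarith [show 0 ≤ x ^ 2 by positivity]
      linarith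
  have hcont : ContinuousOn f (Set.Icc (-R) R ×ˢ Set.Icc 0 (T - s)) := by
    refine ContinuousOn.sub (hD.mono ?_) (ContinuousOn.mul continuousOn_const ?_)
    · exact fun z hz => ⟨trivial, hz.2.1⟩
    · refine ContinuousOn.add (by fun_prop) (ContinuousOn.inv₀ (by fun_prop) ?_)
      intro z hz
      have := hz.2.2
      linarith
  obtain ⟨⟨x₀, t₀⟩, hz, hmax⟩ := (isCompact_Icc.prod isCompact_Icc).exists_isMaxOn
    ⟨(x₁, t₁), by
      obtain ⟨h1, h2, h3⟩ := key x₁ t₁ ht₁ ht₁T hf1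
      exact ⟨abs_le.1 h1.le, h2.le, h3.le⟩⟩ hcont
  have hf0 : 0 < f (x₀, t₀) := by
    refine hf1.trans_le (hmax ?_)
    obtain ⟨h1, h2, h3⟩ := key x₁ t₁ ht₁ ht₁T hf1
    exact ⟨abs_le.1 h1.le, h2.le, h3.le⟩
  have hz2 : t₀ ≤ T - s := hz.2.2
  obtain ⟨h1, h2, h3⟩ := key x₀ t₀ hz.2.1 (by linarith) hf0
  refine ⟨x₀, t₀, h2, by linarith, ?_⟩
  have hn : Set.Icc (-R) R ×ˢ Set.Icc 0 (T - s) ∈ 𝓝 (x₀, t₀) :=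
    prod_mem_nhds (Icc_mem_nhds (abs_lt.1 h1).1 (abs_lt.1 h1).2) (Icc_mem_nhds h2 h3)
  exact hmax.isLocalMax hn

/-- A function that is continuous on `ℝ × [0, ∞)` and `C²` on `ℝ × (0, ∞)`, together with its
partial derivatives, whose space derivative grows at most linearly. -/
structure IsSmoothTest (φ φt φx φxx : ℝ → ℝ → ℝ) (A : ℝ) : Prop where
  continuousOn : ContinuousOn (fun z : ℝ × ℝ => φ z.1 z.2) (Set.univ ×ˢ Set.Ici 0)
  contDiffAt : ∀ x t, 0 < t → ContDiffAt ℝ 2 (fun z : ℝ × ℝ => φ z.1 z.2) (x, t)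
  hasDerivAt_time : ∀ x t, 0 < t → HasDerivAt (fun s => φ x s) (φt x t) t
  hasDerivAt_space : ∀ x t, 0 < t → HasDerivAt (fun y => φ y t) (φx x t) x
  hasDerivAt_space_space : ∀ x t, 0 < t → HasDerivAt (fun y => φx y t) (φxx x t) x
  abs_space_le : ∀ x t, 0 < t → |φx x t| ≤ A * (1 + |x|)

namespace IsSmoothTest

variable {φ φt φx φxx : ℝ → ℝ → ℝ} {A : ℝ}

theorem contDiffAt_penalized (h : IsSmoothTest φ φt φx φxx A) (δ L T : ℝ) {x t : ℝ} (ht : 0 < t)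
    (htT : t < T) :
    ContDiffAt ℝ 2 (fun z : ℝ × ℝ =>
      φ z.1 z.2 + δ * ((1 + z.1 ^ 2) * Real.exp (L * z.2) + (T - z.2)⁻¹)) (x, t) := by
  have hne : T - t ≠ 0 := by linarith
  refine (h.contDiffAt x t ht).add (contDiffAt_const.mul (ContDiffAt.add ?_ (ContDiffAt.inv ?_ hne)))
  · exact ContDiff.contDiffAt (by fun_prop)
  · exact ContDiff.contDiffAt (by fun_prop)

theorem deriv_time_penalized (h : IsSmoothTest φ φt φx φxx A) (δ L T : ℝ) {x t : ℝ} (ht : 0 < t)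
    (htT : t < T) :
    deriv (fun s => φ x s + δ * ((1 + x ^ 2) * Real.exp (L * s) + (T - s)⁻¹)) t
      = φt x t + δ * (L * (1 + x ^ 2) * Real.exp (L * t) + ((T - t) ^ 2)⁻¹) := by
  have hne : T - t ≠ 0 := by linarith
  have h1 : HasDerivAt (fun s => Real.exp (L * s)) (Real.exp (L * t) * (L * 1)) t :=
    ((hasDerivAt_id t).const_mul L).exp
  have h2 : HasDerivAt (fun s => (T - s)⁻¹) (-(-1) / (T - t) ^ 2) t :=
    ((hasDerivAt_id t).const_sub T).inv hne
  have := (h.hasDerivAt_time x t ht).add (((h1.const_mul (1 + x ^ 2)).add h2).const_mul δ)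
  refine (this.congr_deriv ?_).deriv
  simp only [neg_neg, one_div]
  ring

theorem hasDerivAt_space_penalized (h : IsSmoothTest φ φt φx φxx A) (δ L T : ℝ) {x t : ℝ}
    (ht : 0 < t) :
    HasDerivAt (fun y => φ y t + δ * ((1 + y ^ 2) * Real.exp (L * t) + (T - t)⁻¹))
      (φx x t + δ * (2 * x * Real.exp (L * t))) x := by
  have h1 : HasDerivAt (fun y : ℝ => 1 + y ^ 2) (2 * x) x := by
    simpa using ((hasDerivAt_id x).pow 2).const_add 1
  exact (h.hasDerivAt_space x t ht).add
    (((h1.mul_const (Real.exp (L * t))).add_const ((T - t)⁻¹)).const_mul δ)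

theorem iteratedDeriv_two_penalized (h : IsSmoothTest φ φt φx φxx A) (δ L T : ℝ) {x t : ℝ}
    (ht : 0 < t) :
    iteratedDeriv 2 (fun y => φ y t + δ * ((1 + y ^ 2) * Real.exp (L * t) + (T - t)⁻¹)) x
      = φxx x t + δ * (2 * Real.exp (L * t)) := by
  rw [iteratedDeriv_succ, iteratedDeriv_one]
  have h1 : deriv (fun y => φ y t + δ * ((1 + y ^ 2) * Real.exp (L * t) + (T - t)⁻¹))
      = fun y => φx y t + δ * (2 * y * Real.exp (L * t)) :=
    funext fun y => (h.hasDerivAt_space_penalized δ L T ht).deriv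
  rw [h1]
  have h2 : HasDerivAt (fun y : ℝ => 2 * y) 2 x := by
    simpa using (hasDerivAt_id x).const_mul 2
  exact ((h.hasDerivAt_space_space x t ht).add
    ((h2.mul_const (Real.exp (L * t))).const_mul δ)).deriv

/-- This is the cross term produced by squaring the penalized gradient. Being `O(1 + x²)`, it can be
absorbed by the time derivative of `(1 + x²) e^{Lt}`. -/
theorem two_mul_abs_mul_le (h : IsSmoothTest φ φt φx φxx A) (x : ℝ) {t : ℝ} (ht : 0 < t) :
    |φx x t * (2 * x)| ≤ 4 * A * (1 + x ^ 2) := by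
  have h1 := h.abs_space_le x t ht
  have hA : 0 ≤ A := by
    have := (abs_nonneg _).trans (h.abs_space_le 0 t ht)
    simpa using this
  rw [abs_mul, abs_mul, abs_two]
  have h2 : |φx x t| * (2 * |x|) ≤ A * (1 + |x|) * (2 * |x|) := by gcongr
  have h3 : (1 + |x|) * (2 * |x|) ≤ 4 * (1 + x ^ 2) := by
    rw [← sq_abs x]; nlinarith [sq_nonneg (|x| - 1)]
  nlinarith

/-- A viscosity subsolution lies below a smooth supersolution. -/
theorem subsolution_le (h : IsSmoothTest φ φt φx φxx A) {ε : ℝ} (hε : 0 ≤ ε) {u : ℝ → ℝ → ℝ}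
    (hu : ContinuousOn (fun z : ℝ × ℝ => u z.1 z.2) (Set.univ ×ˢ Set.Ici 0))
    (hsub : IsViscositySubsolution (fun p => p ^ 2 / 2) ε u)
    (heq : ∀ x t, 0 < t → ε * φxx x t ≤ φt x t + φx x t ^ 2 / 2)
    (hinit : ∀ x, u x 0 ≤ φ x 0)
    (hgrowth : ∀ T : ℝ, 0 < T → ∃ C : ℝ, ∀ x, ∀ t ∈ Set.Icc 0 T, u x t - φ x t ≤ C * (1 + |x|))
    (x t : ℝ) (ht : 0 ≤ t) : u x t ≤ φ x t := by
  by_contra! hlt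
  obtain ⟨C, hC⟩ := hgrowth (t + 1) (by linarith)
  have hA : 0 ≤ A := by
    have := (abs_nonneg _).trans (h.abs_space_le 0 1 one_pos)
    simpa using this
  -- In `L`, the part `2ε` pays for the diffusion of the penalty and `4A` for the cross term. The
  -- square of the penalty gradient has a favourable sign.
  obtain ⟨δ, hδ, -, x₀, t₀, ht₀, ht₀T, hmax⟩ :=
    exists_penalized_isLocalMax (D := fun x t => u x t - φ x t) (T := t + 1) (L := 2 * ε + 4 * A)
      (η := 1) (hu.sub h.continuousOn) hC (fun x => by linarith [hinit x]) ht (by linarith)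
      (sub_pos.2 hlt) (by positivity) one_pos
  have := hsub (fun x s => φ x s + δ * ((1 + x ^ 2) * Real.exp ((2 * ε + 4 * A) * s) +
    (t + 1 - s)⁻¹)) x₀ t₀ ht₀ (h.contDiffAt_penalized _ _ _ ht₀ ht₀T)
    (by simpa only [sub_sub] using hmax)
  rw [h.deriv_time_penalized _ _ _ ht₀ ht₀T, (h.hasDerivAt_space_penalized _ _ _ ht₀).deriv,
    h.iteratedDeriv_two_penalized _ _ _ ht₀] at this
  set E := Real.exp ((2 * ε + 4 * A) * t₀)
  have hE : 0 < E := Real.exp_pos _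
  have h1 := heq x₀ t₀ ht₀
  have h2 := (abs_le.1 (h.two_mul_abs_mul_le x₀ ht₀)).1
  have h3 : 0 < δ * ((t + 1 - t₀) ^ 2)⁻¹ := by
    have : 0 < t + 1 - t₀ := by linarith
    positivity
  have h4 : 0 ≤ (δ * (2 * x₀ * E)) ^ 2 := sq_nonneg _
  have h5 : -(4 * A * (1 + x₀ ^ 2)) * (δ * E) ≤ φx x₀ t₀ * (2 * x₀) * (δ * E) :=
    mul_le_mul_of_nonneg_right h2 (by positivity)
  have h6 : 0 ≤ ε * x₀ ^ 2 * (δ * E) := by positivity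
  nlinarith

/-- A viscosity supersolution lies above a smooth subsolution. -/
theorem le_supersolution (h : IsSmoothTest φ φt φx φxx A) {ε : ℝ} (hε : 0 ≤ ε) {u : ℝ → ℝ → ℝ}
    (hu : ContinuousOn (fun z : ℝ × ℝ => u z.1 z.2) (Set.univ ×ˢ Set.Ici 0))
    (hsup : IsViscositySupersolution (fun p => p ^ 2 / 2) ε u)
    (heq : ∀ x t, 0 < t → φt x t + φx x t ^ 2 / 2 ≤ ε * φxx x t)
    (hinit : ∀ x, φ x 0 ≤ u x 0)
    (hgrowth : ∀ T : ℝ, 0 < T → ∃ C : ℝ, ∀ x, ∀ t ∈ Set.Icc 0 T, φ x t - u x t ≤ C * (1 + |x|))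
    (x t : ℝ) (ht : 0 ≤ t) : φ x t ≤ u x t := by
  by_contra! hlt
  obtain ⟨C, hC⟩ := hgrowth (t + 1) (by linarith)
  have hA : 0 ≤ A := by
    have := (abs_nonneg _).trans (h.abs_space_le 0 1 one_pos)
    simpa using this
  -- Here the squared penalty gradient, which contributes `2 x² (δE)²`, has the wrong sign. The
  -- choice of `η` below ensures `δE ≤ 1`, after which the extra `2` in `L` absorbs it.
  set L := 2 * ε + 4 * A + 2 with hL
  have hL0 : 0 ≤ L := by positivity
  obtain ⟨δ, hδ, hδ1, x₀, t₀, ht₀, ht₀T, hmax⟩ :=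
    exists_penalized_isLocalMax (D := fun x t => φ x t - u x t) (T := t + 1) (L := L)
      (η := (Real.exp (L * (t + 1)))⁻¹) (h.continuousOn.sub hu) hC
      (fun x => by linarith [hinit x]) ht (by linarith)
      (sub_pos.2 hlt) hL0 (by positivity)
  have := hsup (fun x s => φ x s + (-δ) * ((1 + x ^ 2) * Real.exp (L * s) +
    (t + 1 - s)⁻¹)) x₀ t₀ ht₀ (h.contDiffAt_penalized _ _ _ ht₀ ht₀T)
    (hmax.mono fun z hz => by dsimp only at hz ⊢; linarith)
  rw [h.deriv_time_penalized _ _ _ ht₀ ht₀T, (h.hasDerivAt_space_penalized _ _ _ ht₀).deriv,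
    h.iteratedDeriv_two_penalized _ _ _ ht₀] at this
  have hδE : δ * Real.exp (L * t₀) ≤ 1 := by
    calc δ * Real.exp (L * t₀) ≤ (Real.exp (L * (t + 1)))⁻¹ * Real.exp (L * (t + 1)) := by
          gcongr
      _ = 1 := inv_mul_cancel₀ (Real.exp_pos _).ne'
  set E := Real.exp (L * t₀)
  have hE : 0 < E := Real.exp_pos _
  have h1 := heq x₀ t₀ ht₀
  have h2 := (abs_le.1 (h.two_mul_abs_mul_le x₀ ht₀)).1
  have h3 : 0 < δ * ((t + 1 - t₀) ^ 2)⁻¹ := by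
    have : 0 < t + 1 - t₀ := by linarith
    positivity
  have h5 : -(4 * A * (1 + x₀ ^ 2)) * (δ * E) ≤ φx x₀ t₀ * (2 * x₀) * (δ * E) :=
    mul_le_mul_of_nonneg_right h2 (by positivity)
  have h6 : 0 ≤ ε * x₀ ^ 2 * (δ * E) := by positivity
  have h7 : x₀ ^ 2 * (δ * E) * (δ * E) ≤ x₀ ^ 2 * (δ * E) * 1 := by gcongr
  have h8 : 0 < δ * E := by positivity
  rw [hL] at this
  nlinarith

end IsSmoothTest

/-! ### Moments of exponential weights and their smooth dependence on parameters. -/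

/-- The power is at most `k! e^{|y|}`, and completing the square absorbs all linear exponents into
half of the Gaussian. -/
theorem integrable_abs_pow_mul_exp (k : ℕ) {c : ℝ} (hc : 0 < c) (d : ℝ) :
    Integrable fun y : ℝ => |y| ^ k * Real.exp (-c * y ^ 2 + d * |y|) := by
  have h := (integrable_exp_neg_mul_sq (half_pos hc)).const_mul
    (k.factorial * Real.exp ((d + 1) ^ 2 / (2 * c)))
  refine h.mono' (by fun_prop) (ae_of_all _ fun y => ?_)
  rw [Real.norm_of_nonneg (by positivity)]
  have h1 : |y| ^ k ≤ k.factorial * Real.exp |y| := by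
    have := Real.pow_div_factorial_le_exp |y| (abs_nonneg y) k
    rwa [div_le_iff₀ (by positivity), mul_comm] at this
  have h2 : |y| + (-c * y ^ 2 + d * |y|) ≤ (d + 1) ^ 2 / (2 * c) + -(c / 2) * y ^ 2 := by
    have h3 : (d + 1) ^ 2 / (2 * c) - (d + 1) * |y| + c / 2 * |y| ^ 2
        = (d + 1 - c * |y|) ^ 2 / (2 * c) := by field_simp; ring
    have h4 : 0 ≤ (d + 1 - c * |y|) ^ 2 / (2 * c) := by positivity
    rw [sq_abs] at h3
    linarith
  calc |y| ^ k * Real.exp (-c * y ^ 2 + d * |y|)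
      ≤ k.factorial * Real.exp |y| * Real.exp (-c * y ^ 2 + d * |y|) := by gcongr
    _ = k.factorial * Real.exp (|y| + (-c * y ^ 2 + d * |y|)) := by rw [Real.exp_add |y|]; ring
    _ ≤ k.factorial * Real.exp ((d + 1) ^ 2 / (2 * c) + -(c / 2) * y ^ 2) := by gcongr
    _ = _ := by rw [Real.exp_add]; ring

/-- The integrand of the `k`-th moment of the weight `exp (a y² + b y - G y)`, at `p = (a, b)`. -/
noncomputable def momentIntegrand (G : ℝ → ℝ) (k : ℕ) (p : ℝ × ℝ) (y : ℝ) : ℝ :=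
  y ^ k * Real.exp (p.1 * y ^ 2 + p.2 * y - G y)

/-- The `k`-th moment of the weight `exp (a y² + b y - G y)`, at `p = (a, b)`. -/
noncomputable def moment (G : ℝ → ℝ) (k : ℕ) (p : ℝ × ℝ) : ℝ := ∫ y, momentIntegrand G k p y

section Moment

variable {G : ℝ → ℝ} {A B : ℝ}

theorem continuous_momentIntegrand (hG : Continuous G) (k : ℕ) (p : ℝ × ℝ) :
    Continuous (momentIntegrand G k p) := by
  unfold momentIntegrand; fun_prop

theorem abs_momentIntegrand_le (hGB : ∀ y, -G y ≤ A + B * |y|) (k : ℕ) {p : ℝ × ℝ} {c d : ℝ}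
    (hc : p.1 ≤ -c) (hd : |p.2| ≤ d) (y : ℝ) :
    |momentIntegrand G k p y| ≤
      Real.exp A * (|y| ^ k * Real.exp (-c * y ^ 2 + (d + B) * |y|)) := by
  rw [momentIntegrand, abs_mul, abs_pow, Real.abs_exp]
  have h1 : p.2 * y ≤ d * |y| := by
    refine (le_abs_self _).trans ?_
    rw [abs_mul]
    gcongr
  have h2 : p.1 * y ^ 2 ≤ -c * y ^ 2 := by gcongr
  have h3 := hGB y
  calc |y| ^ k * Real.exp (p.1 * y ^ 2 + p.2 * y - G y)
      ≤ |y| ^ k * Real.exp (A + (-c * y ^ 2 + (d + B) * |y|)) := by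
        gcongr; linarith
    _ = _ := by rw [Real.exp_add]; ring

theorem integrable_momentIntegrand (hG : Continuous G) (hGB : ∀ y, -G y ≤ A + B * |y|) (k : ℕ)
    {p : ℝ × ℝ} (hp : p.1 < 0) : Integrable (momentIntegrand G k p) := by
  refine ((integrable_abs_pow_mul_exp k (neg_pos.2 hp) (|p.2| + B)).const_mul (Real.exp A)).mono'
    (continuous_momentIntegrand hG k p).aestronglyMeasurable (ae_of_all _ fun y => ?_)
  exact abs_momentIntegrand_le hGB k (by linarith) le_rfl y

theorem hasFDerivAt_momentIntegrand (k : ℕ) (p : ℝ × ℝ) (y : ℝ) :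
    HasFDerivAt (fun q => momentIntegrand G k q y)
      (momentIntegrand G (k + 2) p y • ContinuousLinearMap.fst ℝ ℝ ℝ +
        momentIntegrand G (k + 1) p y • ContinuousLinearMap.snd ℝ ℝ ℝ) p := by
  have h1 : HasFDerivAt (fun q : ℝ × ℝ => q.1) (ContinuousLinearMap.fst ℝ ℝ ℝ) p := hasFDerivAt_fst
  have h2 : HasFDerivAt (fun q : ℝ × ℝ => q.2) (ContinuousLinearMap.snd ℝ ℝ ℝ) p := hasFDerivAt_snd
  have h := ((((h1.mul_const (y ^ 2)).add (h2.mul_const y)).sub_const (G y)).exp).const_mul (y ^ k)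
  refine h.congr_fderiv ?_
  ext <;> simp [momentIntegrand] <;> ring

theorem hasFDerivAt_moment (hG : Continuous G) (hGB : ∀ y, -G y ≤ A + B * |y|) (k : ℕ)
    {p : ℝ × ℝ} (hp : p.1 < 0) :
    HasFDerivAt (moment G k)
      (moment G (k + 2) p • ContinuousLinearMap.fst ℝ ℝ ℝ +
        moment G (k + 1) p • ContinuousLinearMap.snd ℝ ℝ ℝ) p := by
  have hi := fun j => integrable_momentIntegrand hG hGB j hp
  -- On the ball of radius `min c 1` the quadratic coefficient stays below `-c` and the linear one
  -- below `|p.2| + 1`, so a single Gaussian-type bound dominates all derivatives.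
  set c := -p.1 / 2 with hc
  have hcpos : 0 < c := by linarith
  set bound : ℝ → ℝ := fun y =>
    Real.exp A * (|y| ^ (k + 2) * Real.exp (-c * y ^ 2 + (|p.2| + 1 + B) * |y|)) +
    Real.exp A * (|y| ^ (k + 1) * Real.exp (-c * y ^ 2 + (|p.2| + 1 + B) * |y|)) with hb
  have h := hasFDerivAt_integral_of_dominated_of_fderiv_le (𝕜 := ℝ) (μ := volume)
    (F := momentIntegrand G k) (x₀ := p) (bound := bound) (s := Metric.ball p (min c 1))
    (F' := fun q y => momentIntegrand G (k + 2) q y • ContinuousLinearMap.fst ℝ ℝ ℝ +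
        momentIntegrand G (k + 1) q y • ContinuousLinearMap.snd ℝ ℝ ℝ)
    (Metric.ball_mem_nhds _ (by positivity))
    (Eventually.of_forall fun q => (continuous_momentIntegrand hG k q).aestronglyMeasurable)
    (hi k)
    (((hi (k + 2)).aestronglyMeasurable.smul_const _).add
      ((hi (k + 1)).aestronglyMeasurable.smul_const _))
    (ae_of_all _ fun y q hq => ?_)
    (Integrable.add ((integrable_abs_pow_mul_exp _ hcpos _).const_mul _)
      ((integrable_abs_pow_mul_exp _ hcpos _).const_mul _))
    (ae_of_all _ fun y q _ => hasFDerivAt_momentIntegrand k q y)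
  · refine h.congr_fderiv ?_
    rw [integral_add ((hi (k + 2)).smul_const _) ((hi (k + 1)).smul_const _), integral_smul_const,
      integral_smul_const]
    rfl
  · rw [Metric.mem_ball, Prod.dist_eq, max_lt_iff, lt_min_iff, lt_min_iff, Real.dist_eq,
      Real.dist_eq] at hq
    have h1 : q.1 ≤ -c := by linarith [(abs_lt.1 hq.1.1).2]
    have h2 : |q.2| ≤ |p.2| + 1 := by
      have := abs_sub_abs_le_abs_sub q.2 p.2
      linarith [hq.2.2]
    refine (norm_add_le _ _).trans (add_le_add ?_ ?_)
    · rw [norm_smul]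
      refine (mul_le_of_le_one_right (norm_nonneg _) (ContinuousLinearMap.norm_fst_le ..)).trans ?_
      exact abs_momentIntegrand_le hGB _ h1 h2 y
    · rw [norm_smul]
      refine (mul_le_of_le_one_right (norm_nonneg _) (ContinuousLinearMap.norm_snd_le ..)).trans ?_
      exact abs_momentIntegrand_le hGB _ h1 h2 y

/-- Differentiation only raises the order of the moment by one or two, so the induction on
smoothness runs over all `k` simultaneously. -/
theorem contDiffOn_moment (hG : Continuous G) (hGB : ∀ y, -G y ≤ A + B * |y|) (n k : ℕ) :
    ContDiffOn ℝ n (moment G k) {p : ℝ × ℝ | p.1 < 0} := by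
  have hopen : IsOpen {p : ℝ × ℝ | p.1 < 0} := isOpen_lt continuous_fst continuous_const
  induction n generalizing k with
  | zero =>
    refine contDiffOn_zero.2 fun p hp => ?_
    exact (hasFDerivAt_moment hG hGB k hp).continuousAt.continuousWithinAt
  | succ n ih =>
    push_cast
    rw [contDiffOn_succ_iff_fderiv_of_isOpen hopen]
    refine ⟨fun p hp => (hasFDerivAt_moment hG hGB k hp).differentiableAt.differentiableWithinAt,
      by simp, ?_⟩
    refine (((ih (k + 2)).smul contDiffOn_const).add ((ih (k + 1)).smul contDiffOn_const)).congr
      fun p hp => (hasFDerivAt_moment hG hGB k hp).fderiv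

theorem moment_zero_pos (hG : Continuous G) (hGB : ∀ y, -G y ≤ A + B * |y|)
    {p : ℝ × ℝ} (hp : p.1 < 0) : 0 < moment G 0 p := by
  refine integral_pos_of_integrable_nonneg_nonzero (x := 0) (continuous_momentIntegrand hG 0 p)
    (integrable_momentIntegrand hG hGB 0 hp) (fun y => ?_) ?_
  · simp only [momentIntegrand, pow_zero, one_mul]; exact (Real.exp_pos _).le
  · simp [momentIntegrand]

/-- The variance of the weight is nonnegative. -/
theorem sq_moment_one_le (hG : Continuous G) (hGB : ∀ y, -G y ≤ A + B * |y|)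
    {p : ℝ × ℝ} (hp : p.1 < 0) :
    (moment G 1 p / moment G 0 p) ^ 2 ≤ moment G 2 p / moment G 0 p := by
  have h0 := moment_zero_pos hG hGB hp
  have hi := fun j => integrable_momentIntegrand hG hGB j hp
  set m := moment G 1 p / moment G 0 p with hm
  have h1 : 0 ≤ ∫ y, (momentIntegrand G 2 p y - 2 * m * momentIntegrand G 1 p y
      + m ^ 2 * momentIntegrand G 0 p y) := by
    refine integral_nonneg fun y => ?_
    have : momentIntegrand G 2 p y - 2 * m * momentIntegrand G 1 p y
      + m ^ 2 * momentIntegrand G 0 p y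
      = (y - m) ^ 2 * Real.exp (p.1 * y ^ 2 + p.2 * y - G y) := by
      simp only [momentIntegrand]; ring
    simp only [this]
    positivity
  have hi' : Integrable fun y => momentIntegrand G 2 p y - 2 * m * momentIntegrand G 1 p y :=
    (hi 2).sub ((hi 1).const_mul _)
  rw [integral_add hi' ((hi 0).const_mul _), integral_sub (hi 2) ((hi 1).const_mul _), integral_const_mul, integral_const_mul] at h1
  change 0 ≤ moment G 2 p - 2 * m * moment G 1 p + m ^ 2 * moment G 0 p at h1
  have h2 : moment G 1 p = m * moment G 0 p := by rw [hm]; field_simp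
  rw [le_div_iff₀ h0]
  rw [h2] at h1
  nlinarith

end Moment

theorem hasDerivAt_moment_comp {G : ℝ → ℝ} {A B : ℝ} (hG : Continuous G)
    (hGB : ∀ y, -G y ≤ A + B * |y|) (k : ℕ) {γ : ℝ → ℝ × ℝ} {γ' : ℝ × ℝ} {s : ℝ}
    (hγ : HasDerivAt γ γ' s) (hs : (γ s).1 < 0) :
    HasDerivAt (fun r => moment G k (γ r))
      (moment G (k + 2) (γ s) * γ'.1 + moment G (k + 1) (γ s) * γ'.2) s := by
  exact ((hasFDerivAt_moment hG hGB k hs).comp_hasDerivAt s hγ).congr_deriv (by simp)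

/-! ### The Cole–Hopf formula: equation, semiconcavity and Laplace bounds. -/

/-- The function minimized in the Hopf–Lax formula. -/
noncomputable def hopfLaxCost (g : ℝ → ℝ) (x t y : ℝ) : ℝ := (x - y) ^ 2 / (2 * t) + g y

/-- The Cole–Hopf formula for the solution of `u_t + u_x² / 2 = ε u_xx` with initial datum `g`. -/
noncomputable def coleHopf (g : ℝ → ℝ) (ε x t : ℝ) : ℝ :=
  ε * Real.log (4 * Real.pi * ε * t) -
    2 * ε * Real.log (∫ y, Real.exp (-hopfLaxCost g x t y / (2 * ε)))

/-- The parameters of the quadratic weight in the Cole–Hopf formula. -/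
noncomputable def coleHopfParam (ε x t : ℝ) : ℝ × ℝ := (-(4 * ε * t)⁻¹, x * (2 * ε * t)⁻¹)

/-- The normalized moments of the weight in the Cole–Hopf formula. -/
noncomputable def coleHopfMoment (g : ℝ → ℝ) (ε : ℝ) (k : ℕ) (x t : ℝ) : ℝ :=
  moment (fun y => g y / (2 * ε)) k (coleHopfParam ε x t) /
    moment (fun y => g y / (2 * ε)) 0 (coleHopfParam ε x t)

section ColeHopf

variable {g : ℝ → ℝ} {K : ℝ≥0} {ε : ℝ}

theorem coleHopfParam_fst_neg (hε : 0 < ε) (x : ℝ) {t : ℝ} (ht : 0 < t) :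
    (coleHopfParam ε x t).1 < 0 := by
  simp only [coleHopfParam]
  have : 0 < (4 * ε * t)⁻¹ := by positivity
  linarith

theorem exp_neg_hopfLaxCost (hε : 0 < ε) (x : ℝ) {t : ℝ} (ht : 0 < t) (y : ℝ) :
    Real.exp (-hopfLaxCost g x t y / (2 * ε)) = Real.exp (-x ^ 2 / (4 * ε * t)) *
      momentIntegrand (fun y => g y / (2 * ε)) 0 (coleHopfParam ε x t) y := by
  rw [momentIntegrand, pow_zero, one_mul, ← Real.exp_add]
  congr 1
  simp only [hopfLaxCost, coleHopfParam]
  field_simp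
  ring

theorem neg_div_le_of_lipschitz (hg : LipschitzWith K g) (hε : 0 < ε) (y : ℝ) :
    -(g y / (2 * ε)) ≤ |g 0| / (2 * ε) + K / (2 * ε) * |y| := by
  have h1 := hg.dist_le_mul y 0
  rw [Real.dist_eq, Real.dist_eq, sub_zero] at h1
  have h2 : -g y ≤ |g 0| + K * |y| := by
    linarith [neg_abs_le (g y - g 0), neg_abs_le (g 0)]
  calc -(g y / (2 * ε)) = -g y / (2 * ε) := by ring
    _ ≤ (|g 0| + K * |y|) / (2 * ε) := by gcongr
    _ = _ := by ring

theorem integrable_exp_neg_hopfLaxCost (hg : LipschitzWith K g) (hε : 0 < ε) (x : ℝ) {t : ℝ}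
    (ht : 0 < t) : Integrable fun y => Real.exp (-hopfLaxCost g x t y / (2 * ε)) := by
  simp only [exp_neg_hopfLaxCost hε x ht]
  exact (integrable_momentIntegrand (hg.continuous.div_const _) (neg_div_le_of_lipschitz hg hε) 0
    (coleHopfParam_fst_neg hε x ht)).const_mul _

theorem integral_exp_neg_hopfLaxCost_pos (hg : LipschitzWith K g) (hε : 0 < ε) (x : ℝ) {t : ℝ}
    (ht : 0 < t) : 0 < ∫ y, Real.exp (-hopfLaxCost g x t y / (2 * ε)) :=
  integral_exp_pos (integrable_exp_neg_hopfLaxCost hg hε x ht)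

/-- Expanding the square confines the dependence of the integral on `x` and `t` to the two
coefficients of the weight, so differentiation reduces to that of moments. -/
theorem coleHopf_eq (hg : LipschitzWith K g) (hε : 0 < ε) (x : ℝ) {t : ℝ} (ht : 0 < t) :
    coleHopf g ε x t = x ^ 2 / (2 * t) + ε * Real.log (4 * Real.pi * ε * t) -
      2 * ε * Real.log (moment (fun y => g y / (2 * ε)) 0 (coleHopfParam ε x t)) := by
  have h0 := moment_zero_pos (hg.continuous.div_const (2 * ε)) (neg_div_le_of_lipschitz hg hε)
    (coleHopfParam_fst_neg hε x ht)
  have h1 : ∫ y, Real.exp (-hopfLaxCost g x t y / (2 * ε)) = Real.exp (-x ^ 2 / (4 * ε * t)) *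
      moment (fun y => g y / (2 * ε)) 0 (coleHopfParam ε x t) := by
    simp only [exp_neg_hopfLaxCost hε x ht, integral_const_mul, moment]
  rw [coleHopf, h1, Real.log_mul (Real.exp_pos _).ne' h0.ne', Real.log_exp]
  field_simp
  ring

theorem hasDerivAt_coleHopfParam_space (x t : ℝ) :
    HasDerivAt (fun y => coleHopfParam ε y t) (0, (2 * ε * t)⁻¹) x := by
  refine HasDerivAt.prodMk (hasDerivAt_const _ _) ?_
  simpa using (hasDerivAt_id x).mul_const (2 * ε * t)⁻¹

theorem hasDerivAt_coleHopfParam_time (hε : 0 < ε) (x : ℝ) {t : ℝ} (ht : 0 < t) :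
    HasDerivAt (fun s => coleHopfParam ε x s)
      ((4 * ε * t ^ 2)⁻¹, -(x * (2 * ε * t ^ 2)⁻¹)) t := by
  have h (c : ℝ) (hc : 0 < c) : HasDerivAt (fun s => (c * s)⁻¹) (-(c * t ^ 2)⁻¹) t := by
    have := ((hasDerivAt_id t).const_mul c).inv (by positivity)
    refine this.congr_deriv ?_
    simp only [id, mul_one]
    field_simp
  refine HasDerivAt.prodMk ?_ ?_
  · exact (h (4 * ε) (by positivity)).fun_neg.congr_deriv (neg_neg _)
  · simpa using (h (2 * ε) (by positivity)).const_mul x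

theorem hasDerivAt_coleHopf_space (hg : LipschitzWith K g) (hε : 0 < ε) (x : ℝ) {t : ℝ}
    (ht : 0 < t) :
    HasDerivAt (fun y => coleHopf g ε y t) ((x - coleHopfMoment g ε 1 x t) / t) x := by
  have hG := hg.continuous.div_const (2 * ε)
  have hGB := neg_div_le_of_lipschitz hg hε
  have hp := coleHopfParam_fst_neg hε x ht
  have h0 := moment_zero_pos hG hGB hp
  have h1 := hasDerivAt_moment_comp hG hGB 0 (hasDerivAt_coleHopfParam_space x t) hp
  have h2 := (((((hasDerivAt_id x).pow 2).div_const (2 * t)).add_const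
    (ε * Real.log (4 * Real.pi * ε * t))).sub ((h1.log h0.ne').const_mul (2 * ε)))
  simp only [coleHopf_eq hg hε _ ht]
  refine h2.congr_deriv ?_
  simp only [coleHopfMoment, id]
  field_simp
  norm_num
  ring

/-- The subtracted numerator is the variance of the weight, whose sign gives semiconcavity. -/
theorem hasDerivAt_coleHopf_space_space (hg : LipschitzWith K g) (hε : 0 < ε) (x : ℝ) {t : ℝ}
    (ht : 0 < t) :
    HasDerivAt (fun y => (y - coleHopfMoment g ε 1 y t) / t)
      (1 / t - (coleHopfMoment g ε 2 x t - coleHopfMoment g ε 1 x t ^ 2) / (2 * ε * t ^ 2)) x := by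
  have hG := hg.continuous.div_const (2 * ε)
  have hGB := neg_div_le_of_lipschitz hg hε
  have hp := coleHopfParam_fst_neg hε x ht
  have h0 := moment_zero_pos hG hGB hp
  have h1 := hasDerivAt_moment_comp hG hGB 0 (hasDerivAt_coleHopfParam_space x t) hp
  have h2 := hasDerivAt_moment_comp hG hGB 1 (hasDerivAt_coleHopfParam_space x t) hp
  refine (((hasDerivAt_id x).sub (h2.div h1 h0.ne')).div_const t).congr_deriv ?_
  simp only [coleHopfMoment]
  field_simp
  ring

theorem hasDerivAt_coleHopf_time (hg : LipschitzWith K g) (hε : 0 < ε) (x : ℝ) {t : ℝ}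
    (ht : 0 < t) :
    HasDerivAt (fun s => coleHopf g ε x s)
      (-x ^ 2 / (2 * t ^ 2) + ε / t - coleHopfMoment g ε 2 x t / (2 * t ^ 2) +
        x * coleHopfMoment g ε 1 x t / t ^ 2) t := by
  have hG := hg.continuous.div_const (2 * ε)
  have hGB := neg_div_le_of_lipschitz hg hε
  have hp := coleHopfParam_fst_neg hε x ht
  have h0 := moment_zero_pos hG hGB hp
  have h1 := hasDerivAt_moment_comp hG hGB 0 (hasDerivAt_coleHopfParam_time hε x ht) hp
  have h3 : HasDerivAt (fun s => x ^ 2 / (2 * s)) (x ^ 2 * (-2 / (2 * t) ^ 2)) t := by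
    have := (((hasDerivAt_id t).const_mul 2).inv (by positivity)).const_mul (x ^ 2)
    simpa [div_eq_mul_inv] using this
  have h4 : HasDerivAt (fun s => Real.log (4 * Real.pi * ε * s))
      (4 * Real.pi * ε / (4 * Real.pi * ε * t)) t := by
    have := ((hasDerivAt_id t).const_mul (4 * Real.pi * ε)).log
      (show 4 * Real.pi * ε * id t ≠ 0 by have := Real.pi_pos; simp only [id]; positivity)
    simpa using this
  have h2 := ((h3.add (h4.const_mul ε)).sub ((h1.log h0.ne').const_mul (2 * ε)))
  have hev : (fun s => coleHopf g ε x s) =ᶠ[𝓝 t] fun s =>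
      x ^ 2 / (2 * s) + ε * Real.log (4 * Real.pi * ε * s) -
      2 * ε * Real.log (moment (fun y => g y / (2 * ε)) 0 (coleHopfParam ε x s)) := by
    filter_upwards [lt_mem_nhds ht] with s hs using coleHopf_eq hg hε x hs
  refine (h2.congr_deriv ?_).congr_of_eventuallyEq hev
  have hpi := Real.pi_pos
  simp only [coleHopfMoment]
  field_simp
  ring

theorem contDiffAt_coleHopf (hg : LipschitzWith K g) (hε : 0 < ε) (x : ℝ) {t : ℝ} (ht : 0 < t) :
    ContDiffAt ℝ 2 (fun z : ℝ × ℝ => coleHopf g ε z.1 z.2) (x, t) := by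
  have hG := hg.continuous.div_const (2 * ε)
  have hGB := neg_div_le_of_lipschitz hg hε
  have hp := coleHopfParam_fst_neg hε x ht
  have h0 := moment_zero_pos hG hGB hp
  have hM : ContDiffAt ℝ 2 (moment (fun y => g y / (2 * ε)) 0) (coleHopfParam ε x t) :=
    (contDiffOn_moment hG hGB 2 0).contDiffAt
      ((isOpen_lt continuous_fst continuous_const).mem_nhds hp)
  have hP : ContDiffAt ℝ 2 (fun z : ℝ × ℝ => coleHopfParam ε z.1 z.2) (x, t) := by
    refine ContDiffAt.prodMk ?_ ?_
    · exact (ContDiffAt.inv (by fun_prop) (by simp; constructor <;> positivity)).neg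
    · exact contDiffAt_fst.mul (ContDiffAt.inv (by fun_prop) (by simp; constructor <;> positivity))
  have hlog := ContDiffAt.log (ContDiffAt.comp (x, t) (g := moment (fun y => g y / (2 * ε)) 0)
    hM hP) h0.ne'
  have hev : (fun z : ℝ × ℝ => coleHopf g ε z.1 z.2) =ᶠ[𝓝 (x, t)] fun z =>
      z.1 ^ 2 / (2 * z.2) + ε * Real.log (4 * Real.pi * ε * z.2) -
      2 * ε * Real.log (moment (fun y => g y / (2 * ε)) 0 (coleHopfParam ε z.1 z.2)) := by
    filter_upwards [continuousAt_snd.eventually (lt_mem_nhds ht)] with z hz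
      using coleHopf_eq hg hε z.1 hz
  refine ContDiffAt.congr_of_eventuallyEq ?_ hev
  have hpi := Real.pi_pos
  refine (ContDiffAt.add ?_ (contDiffAt_const.mul (ContDiffAt.log (by fun_prop) ?_))).sub
    (contDiffAt_const.mul hlog)
  · exact ContDiffAt.div (by fun_prop) (by fun_prop) (by simp; positivity)
  · simp only; positivity

/-- The Cole–Hopf formula solves the viscous equation. -/
theorem coleHopf_equation (hε : 0 < ε) (x : ℝ) {t : ℝ} (ht : 0 < t) :
    (-x ^ 2 / (2 * t ^ 2) + ε / t - coleHopfMoment g ε 2 x t / (2 * t ^ 2) +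
        x * coleHopfMoment g ε 1 x t / t ^ 2) + ((x - coleHopfMoment g ε 1 x t) / t) ^ 2 / 2
      = ε * (1 / t - (coleHopfMoment g ε 2 x t - coleHopfMoment g ε 1 x t ^ 2) /
          (2 * ε * t ^ 2)) := by
  field_simp
  ring

/-- Semiconcavity of the Cole–Hopf formula. -/
theorem coleHopf_semiconcave (hg : LipschitzWith K g) (hε : 0 < ε) (x : ℝ) {t : ℝ} (ht : 0 < t) :
    1 / t - (coleHopfMoment g ε 2 x t - coleHopfMoment g ε 1 x t ^ 2) / (2 * ε * t ^ 2)
      ≤ 1 / t := by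
  have h := sq_moment_one_le (hg.continuous.div_const (2 * ε)) (neg_div_le_of_lipschitz hg hε)
    (coleHopfParam_fst_neg hε x ht)
  have : 0 ≤ (coleHopfMoment g ε 2 x t - coleHopfMoment g ε 1 x t ^ 2) / (2 * ε * t ^ 2) :=
    div_nonneg (sub_nonneg.2 h) (by positivity)
  linarith

/-- Substituting `z = x - y` moves `x` into the argument of `g`, so Lipschitz bounds on `g` pass to
the integral. -/
theorem integral_exp_neg_hopfLaxCost_eq (x t : ℝ) :
    ∫ y, Real.exp (-hopfLaxCost g x t y / (2 * ε)) =
      ∫ z, Real.exp (-(z ^ 2 / (2 * t) + g (x - z)) / (2 * ε)) := by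
  rw [← integral_sub_left_eq_self _ volume x]
  simp [hopfLaxCost]

theorem coleHopf_le_add (hg : LipschitzWith K g) (hε : 0 < ε) {t : ℝ} (ht : 0 < t) (x x' : ℝ) :
    coleHopf g ε x t ≤ coleHopf g ε x' t + K * |x - x'| := by
  have h : ∀ x, Integrable fun z => Real.exp (-(z ^ 2 / (2 * t) + g (x - z)) / (2 * ε)) := by
    intro x
    have := (integrable_exp_neg_hopfLaxCost hg hε x ht).comp_sub_left x
    simpa [hopfLaxCost] using this
  have h0 := integral_exp_neg_hopfLaxCost_pos hg hε x ht
  have h0' := integral_exp_neg_hopfLaxCost_pos hg hε x' ht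
  have hle : ∫ y, Real.exp (-hopfLaxCost g x' t y / (2 * ε)) ≤ Real.exp (K * |x - x'| / (2 * ε)) *
      ∫ y, Real.exp (-hopfLaxCost g x t y / (2 * ε)) := by
    rw [integral_exp_neg_hopfLaxCost_eq, integral_exp_neg_hopfLaxCost_eq, ← integral_const_mul]
    refine integral_mono (h x') ((h x).const_mul _) fun z => ?_
    simp only
    rw [← Real.exp_add, ← add_div]
    gcongr
    have := hg.dist_le_mul (x - z) (x' - z)
    rw [Real.dist_eq, Real.dist_eq, sub_sub_sub_cancel_right] at this
    linarith [le_abs_self (g (x - z) - g (x' - z))]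
  have hlog := Real.log_le_log h0' hle
  rw [Real.log_mul (Real.exp_pos _).ne' h0.ne', Real.log_exp] at hlog
  have h3 : 2 * ε * (K * |x - x'| / (2 * ε)) = K * |x - x'| := by field_simp
  have h4 := mul_le_mul_of_nonneg_left hlog (show 0 ≤ 2 * ε by positivity)
  rw [mul_add, h3] at h4
  simp only [coleHopf]
  linarith

theorem lipschitzWith_coleHopf (hg : LipschitzWith K g) (hε : 0 < ε) {t : ℝ} (ht : 0 < t) :
    LipschitzWith K fun x => coleHopf g ε x t :=
  LipschitzWith.of_le_add_mul K fun x x' => by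
    simpa [Real.dist_eq] using coleHopf_le_add hg hε ht x x'

/-- Laplace-type upper bound for the Cole–Hopf formula. -/
theorem coleHopf_le_of_le (hg : LipschitzWith K g) (hε : 0 < ε) {x t : ℝ} (ht : 0 < t)
    {y₀ r B : ℝ} (hr : 0 < r)
    (hB : ∀ y ∈ Set.Icc (y₀ - r) (y₀ + r), hopfLaxCost g x t y ≤ hopfLaxCost g x t y₀ + B) :
    coleHopf g ε x t ≤ hopfLaxCost g x t y₀ + B + ε * Real.log (Real.pi * ε * t / r ^ 2) := by
  have hi := integrable_exp_neg_hopfLaxCost hg hε x ht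
  set m := hopfLaxCost g x t y₀ + B
  have hle : Real.exp (-m / (2 * ε)) * (2 * r) ≤
      ∫ y, Real.exp (-hopfLaxCost g x t y / (2 * ε)) := by
    calc Real.exp (-m / (2 * ε)) * (2 * r)
        = ∫ y in Set.Icc (y₀ - r) (y₀ + r), Real.exp (-m / (2 * ε)) := by
          rw [setIntegral_const, measureReal_def, Real.volume_Icc, ENNReal.toReal_ofReal (by linarith),
            smul_eq_mul]
          ring
      _ ≤ ∫ y in Set.Icc (y₀ - r) (y₀ + r), Real.exp (-hopfLaxCost g x t y / (2 * ε)) := by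
          refine setIntegral_mono_on (by simp) hi.integrableOn measurableSet_Icc fun y hy => ?_
          gcongr
          exact hB y hy
      _ ≤ _ := setIntegral_le_integral hi (ae_of_all _ fun y => (Real.exp_pos _).le)
  have hlog := Real.log_le_log (by positivity) hle
  rw [Real.log_mul (Real.exp_pos _).ne' (by positivity), Real.log_exp] at hlog
  have h4 := mul_le_mul_of_nonneg_left hlog (show 0 ≤ 2 * ε by positivity)
  have h5 : 2 * ε * (-m / (2 * ε)) = -m := by field_simp
  -- The interval length `2r` enters with coefficient `2ε`, hence as `(2r)²` under the logarithm
  -- with coefficient `ε`.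
  have h6 : Real.log (4 * Real.pi * ε * t) =
      Real.log (Real.pi * ε * t / r ^ 2) + 2 * Real.log (2 * r) := by
    have hpi := Real.pi_pos
    rw [← Real.log_rpow (by positivity), ← Real.log_mul (by positivity) (by positivity)]
    congr 1
    norm_num
    field_simp
    ring
  rw [mul_add, h5] at h4
  rw [coleHopf, h6]
  linarith

/-- Laplace-type lower bound for the Cole–Hopf formula. -/
theorem le_coleHopf_of_integral_le (hg : LipschitzWith K g) (hε : 0 < ε) {x t : ℝ} (ht : 0 < t)
    {m J : ℝ} (hJ : ∫ y, Real.exp (-(hopfLaxCost g x t y - m) / (2 * ε)) ≤ J) :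
    m + ε * Real.log (4 * Real.pi * ε * t) - 2 * ε * Real.log J ≤ coleHopf g ε x t := by
  have h0 := integral_exp_neg_hopfLaxCost_pos hg hε x ht
  have h1 : ∫ y, Real.exp (-(hopfLaxCost g x t y - m) / (2 * ε)) =
      Real.exp (m / (2 * ε)) * ∫ y, Real.exp (-hopfLaxCost g x t y / (2 * ε)) := by
    rw [← integral_const_mul]
    congr 1
    funext y
    rw [← Real.exp_add]
    congr 1
    ring
  rw [h1] at hJ
  have hlog := Real.log_le_log (by positivity) hJ
  rw [Real.log_mul (Real.exp_pos _).ne' h0.ne', Real.log_exp] at hlog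
  have h3 : 2 * ε * (m / (2 * ε)) = m := by field_simp
  have h4 := mul_le_mul_of_nonneg_left hlog (show 0 ≤ 2 * ε by positivity)
  rw [mul_add, h3] at h4
  simp only [coleHopf]
  linarith

end ColeHopf

/-! ### Uniform attainment of the initial datum. -/

section InitialDatum

variable {g : ℝ → ℝ} {K : ℝ≥0} {ε : ℝ}

theorem abs_exp_sub_one_le_abs_mul_exp (s : ℝ) : |Real.exp s - 1| ≤ |s| * Real.exp |s| := by
  rw [abs_le]
  constructor
  · have h1 := Real.add_one_le_exp s
    have h2 : |s| * 1 ≤ |s| * Real.exp |s| := by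
      gcongr; exact Real.one_le_exp (abs_nonneg s)
    linarith [neg_abs_le s]
  · have h1 := Real.add_one_le_exp (-s)
    have h3 : Real.exp s * Real.exp (-s) = 1 := by rw [← Real.exp_add]; simp
    have h4 : Real.exp s - 1 ≤ s * Real.exp s := by
      nlinarith [Real.exp_pos s]
    have h5 : s * Real.exp s ≤ |s| * Real.exp |s| := by
      gcongr <;> exact le_abs_self s
    exact h4.trans h5

theorem integrable_exp_mul_abs (hε : 0 < ε) (r : ℝ) :
    Integrable fun z : ℝ => Real.exp (-z ^ 2 / (4 * ε)) * (r * |z| * Real.exp (r * |z|)) := by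
  have h := (integrable_abs_pow_mul_exp 1 (show 0 < (4 * ε)⁻¹ by positivity) r).const_mul r
  refine h.congr (ae_of_all _ fun z => ?_)
  simp only [Real.exp_add, pow_one]
  rw [show -z ^ 2 / (4 * ε) = -(4 * ε)⁻¹ * z ^ 2 by ring]
  ring

/-- The mass of the Cole–Hopf weight is asymptotic to that of the heat kernel at small times. -/
theorem exists_abs_integral_exp_neg_hopfLaxCost_sub_le (hg : LipschitzWith K g) (hε : 0 < ε) :
    ∃ C, ∀ τ, 0 < τ → τ ≤ 1 → ∀ x,
      |Real.exp (g x / (2 * ε)) * (∫ y, Real.exp (-hopfLaxCost g x τ y / (2 * ε)))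
        - √(4 * Real.pi * ε * τ)| ≤ C * τ := by
  set r := (K : ℝ) / (2 * ε) with hr
  have hr0 : 0 ≤ r := by positivity
  set F : ℝ → ℝ := fun z => Real.exp (-z ^ 2 / (4 * ε)) * (r * |z| * Real.exp (r * |z|)) with hF
  have hFi : Integrable F := integrable_exp_mul_abs hε r
  refine ⟨∫ z, F z, fun τ hτ hτ1 x => ?_⟩
  have hs : 0 < √τ := Real.sqrt_pos.2 hτ
  have hs1 : √τ ≤ 1 := Real.sqrt_le_one.2 hτ1
  have hss : √τ ^ 2 = τ := Real.sq_sqrt hτ.le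
  have hGauss : √(4 * Real.pi * ε * τ) = ∫ z : ℝ, Real.exp (-(4 * ε * τ)⁻¹ * z ^ 2) := by
    rw [integral_gaussian]
    congr 1
    field_simp
  have hGi : Integrable fun z : ℝ => Real.exp (-(4 * ε * τ)⁻¹ * z ^ 2) :=
    integrable_exp_neg_mul_sq (by positivity)
  have hHi : Integrable fun z => Real.exp (g x / (2 * ε)) *
      Real.exp (-(z ^ 2 / (2 * τ) + g (x - z)) / (2 * ε)) := by
    have := (integrable_exp_neg_hopfLaxCost hg hε x hτ).comp_sub_left x
    exact Integrable.const_mul (by simpa [hopfLaxCost] using this) _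
  -- One factor `√τ` comes from the Lipschitz increment `|z| = √τ |ζ|`, the other from the Jacobian.
  -- The error `O(τ)` is thus small relative to the heat kernel mass, of order `√τ`.
  have hscale : ∫ z, √τ * F ((√τ)⁻¹ * z) = (∫ z, F z) * τ := by
    rw [integral_const_mul, Measure.integral_comp_mul_left, inv_inv, abs_of_pos hs, smul_eq_mul]
    rw [← hss]; ring_nf
    simp
  rw [integral_exp_neg_hopfLaxCost_eq, ← integral_const_mul, hGauss, ← integral_sub hHi hGi,
    ← hscale, ← Real.norm_eq_abs]
  refine norm_integral_le_of_norm_le ((hFi.comp_mul_left' (inv_ne_zero hs.ne')).const_mul _)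
    (ae_of_all _ fun z => ?_)
  have h1 : Real.exp (g x / (2 * ε)) * Real.exp (-(z ^ 2 / (2 * τ) + g (x - z)) / (2 * ε)) -
      Real.exp (-(4 * ε * τ)⁻¹ * z ^ 2) =
      Real.exp (-(4 * ε * τ)⁻¹ * z ^ 2) * (Real.exp ((g x - g (x - z)) / (2 * ε)) - 1) := by
    rw [mul_sub, mul_one, ← Real.exp_add, ← Real.exp_add]
    congr 2
    field_simp
    ring
  rw [h1, norm_mul, Real.norm_eq_abs, Real.abs_exp, Real.norm_eq_abs]
  have h2 : |(g x - g (x - z)) / (2 * ε)| ≤ r * |z| := by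
    have := hg.dist_le_mul x (x - z)
    rw [Real.dist_eq, Real.dist_eq, sub_sub_cancel] at this
    rw [abs_div, abs_of_pos (show 0 < 2 * ε by positivity), hr, div_mul_eq_mul_div]
    gcongr
  have hz : |z| = √τ * |(√τ)⁻¹ * z| := by
    rw [abs_mul, abs_of_pos (inv_pos.2 hs)]; field_simp
  have hz2 : -(4 * ε * τ)⁻¹ * z ^ 2 = -((√τ)⁻¹ * z) ^ 2 / (4 * ε) := by
    rw [mul_pow, inv_pow, hss]; field_simp
  rw [hz2]
  simp only [hF]
  set ζ := (√τ)⁻¹ * z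
  have h3 : r * |z| ≤ r * |ζ| := by
    rw [hz]; gcongr; exact mul_le_of_le_one_left (abs_nonneg _) hs1
  have h4 : |Real.exp ((g x - g (x - z)) / (2 * ε)) - 1| ≤ √τ * (r * |ζ| * Real.exp (r * |ζ|)) := by
    calc _ ≤ _ := abs_exp_sub_one_le_abs_mul_exp _
      _ ≤ r * |z| * Real.exp (r * |z|) := by gcongr
      _ ≤ r * |z| * Real.exp (r * |ζ|) := by gcongr
      _ = _ := by rw [hz]; ring
  calc _ ≤ Real.exp (-ζ ^ 2 / (4 * ε)) * (√τ * (r * |ζ| * Real.exp (r * |ζ|))) := by gcongr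
    _ = _ := by ring

/-- The Cole–Hopf formula attains the initial datum uniformly. -/
theorem eventually_abs_coleHopf_sub_le (hg : LipschitzWith K g) (hε : 0 < ε) {κ : ℝ} (hκ : 0 < κ) :
    ∀ᶠ τ in 𝓝[>] (0 : ℝ), ∀ x, |coleHopf g ε x τ - g x| ≤ κ := by
  obtain ⟨C, hC⟩ := exists_abs_integral_exp_neg_hopfLaxCost_sub_le hg hε
  have hlog : ∀ᶠ ρ in 𝓝 (1 : ℝ), |2 * ε * Real.log ρ| < κ := by
    have : ContinuousAt (fun ρ => |2 * ε * Real.log ρ|) 1 :=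
      (continuousAt_const.mul (Real.continuousAt_log one_ne_zero)).abs
    refine this.eventually (gt_mem_nhds ?_)
    simpa using hκ
  obtain ⟨δ, hδ, hδlog⟩ := Metric.eventually_nhds_iff.1 hlog
  have hpi := Real.pi_pos
  have hlim : Tendsto (fun τ : ℝ => C * √τ / √(4 * Real.pi * ε)) (𝓝 0) (𝓝 0) := by
    have : Continuous fun τ : ℝ => C * √τ / √(4 * Real.pi * ε) := by fun_prop
    simpa using this.tendsto 0
  filter_upwards [self_mem_nhdsWithin, nhdsWithin_le_nhds (hlim.eventually (gt_mem_nhds hδ)),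
    nhdsWithin_le_nhds (gt_mem_nhds one_pos)] with τ hτ hτδ hτ1 x
  have hτ : 0 < τ := hτ
  have hI := integral_exp_neg_hopfLaxCost_pos hg hε x hτ
  have h1 := hC τ hτ hτ1.le x
  set I := ∫ y, Real.exp (-hopfLaxCost g x τ y / (2 * ε))
  set Q := √(4 * Real.pi * ε * τ) with hQ
  have hQpos : 0 < Q := Real.sqrt_pos.2 (by positivity)
  have hQ' : Q = √(4 * Real.pi * ε) * √τ := Real.sqrt_mul (by positivity) _
  -- The ratio `ρ` of the two masses is within `O(√τ)` of `1`, uniformly in `x`, and the error of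
  -- Cole–Hopf is exactly `-2ε log ρ`.
  have hρ : dist (Real.exp (g x / (2 * ε)) * I / Q) 1 < δ := by
    rw [Real.dist_eq, div_sub_one hQpos.ne', abs_div, abs_of_pos hQpos]
    refine lt_of_le_of_lt ?_ hτδ
    have hs : 0 < √τ := Real.sqrt_pos.2 hτ
    have h4 : 0 < √(4 * Real.pi * ε) := Real.sqrt_pos.2 (by positivity)
    rw [hQ', div_le_div_iff₀ (by positivity) h4, ← hQ']
    calc _ ≤ C * τ * √(4 * Real.pi * ε) := by gcongr
      _ = C * (√τ * √τ) * √(4 * Real.pi * ε) := by rw [Real.mul_self_sqrt hτ.le]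
      _ = _ := by rw [hQ']; ring
  have h2 := hδlog hρ
  have hU : coleHopf g ε x τ = ε * Real.log (4 * Real.pi * ε * τ) - 2 * ε * Real.log I := rfl
  have h3 : coleHopf g ε x τ - g x = -(2 * ε * Real.log (Real.exp (g x / (2 * ε)) * I / Q)) := by
    rw [Real.log_div (by positivity) hQpos.ne', Real.log_mul (Real.exp_pos _).ne' hI.ne',
      Real.log_exp, hQ, Real.log_sqrt (by positivity), hU]
    field_simp
    ring
  rw [h3, abs_neg]
  exact h2.le

end InitialDatum

/-! ### Identification of the viscous solution. -/

section ShiftedColeHopf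

variable {g : ℝ → ℝ} {K : ℝ≥0} {ε : ℝ}

/-- Time shifts of the Cole–Hopf formula, corrected by a function of time, are smooth tests. -/
theorem isSmoothTest_coleHopf (hg : LipschitzWith K g) (hε : 0 < ε) {τ : ℝ} (hτ : 0 < τ)
    (b c : ℝ) :
    IsSmoothTest (fun x t => coleHopf g ε x (t + τ) + (c - b * Real.log ((t + τ) / τ)))
      (fun x t => (-x ^ 2 / (2 * (t + τ) ^ 2) + ε / (t + τ) -
        coleHopfMoment g ε 2 x (t + τ) / (2 * (t + τ) ^ 2) +
        x * coleHopfMoment g ε 1 x (t + τ) / (t + τ) ^ 2) + -(b / (t + τ)))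
      (fun x t => (x - coleHopfMoment g ε 1 x (t + τ)) / (t + τ))
      (fun x t => 1 / (t + τ) - (coleHopfMoment g ε 2 x (t + τ) -
        coleHopfMoment g ε 1 x (t + τ) ^ 2) / (2 * ε * (t + τ) ^ 2)) K := by
  have hcd : ∀ x t, 0 ≤ t → ContDiffAt ℝ 2 (fun z : ℝ × ℝ => coleHopf g ε z.1 (z.2 + τ) +
      (c - b * Real.log ((z.2 + τ) / τ))) (x, t) := by
    intro x t ht
    have h1 : ContDiffAt ℝ 2 (fun z : ℝ × ℝ => (z.1, z.2 + τ)) (x, t) := by fun_prop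
    have h2 := ContDiffAt.comp (x, t) (g := fun z : ℝ × ℝ => coleHopf g ε z.1 z.2)
      (contDiffAt_coleHopf hg hε x (show 0 < t + τ by positivity)) h1
    have h3 : ContDiffAt ℝ 2 (fun z : ℝ × ℝ => Real.log ((z.2 + τ) / τ)) (x, t) :=
      ContDiffAt.log (by fun_prop) (by simp only; positivity)
    exact h2.add (contDiffAt_const.sub (contDiffAt_const.mul h3))
  refine ⟨fun z hz => (hcd z.1 z.2 hz.2).continuousAt.continuousWithinAt,
    fun x t ht => hcd x t ht.le, fun x t ht => ?_, fun x t ht => ?_, fun x t ht => ?_,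
    fun x t ht => ?_⟩
  · have h0 : 0 < t + τ := by positivity
    have h1 := (hasDerivAt_coleHopf_time hg hε x h0).comp_add_const t τ
    have h2 : HasDerivAt (fun s => Real.log ((s + τ) / τ)) (1 / τ / ((t + τ) / τ)) t :=
      (((hasDerivAt_id t).add_const τ).div_const τ).log (by simp only [id]; positivity)
    refine (h1.add ((h2.const_mul b).const_sub c)).congr_deriv ?_
    field_simp
  · exact (hasDerivAt_coleHopf_space hg hε x (by positivity)).add_const _
  · exact hasDerivAt_coleHopf_space_space hg hε x (by positivity)
  · have h0 : 0 < t + τ := by positivity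
    have h1 := (hasDerivAt_coleHopf_space hg hε x h0).le_of_lipschitz
      (lipschitzWith_coleHopf hg hε h0)
    rw [Real.norm_eq_abs] at h1
    exact h1.trans (le_mul_of_one_le_right K.2 (by linarith [abs_nonneg x]))

/-- Compactness in time bounds the function at `x = 0`, and the Lipschitz bound in `x` does the
rest. The time shift keeps `t + τ` away from the singular time. -/
theorem exists_abs_shifted_coleHopf_le (hg : LipschitzWith K g) (hε : 0 < ε) {τ : ℝ} (hτ : 0 < τ)
    (b c T : ℝ) :
    ∃ C, ∀ x, ∀ t ∈ Set.Icc 0 T,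
      |coleHopf g ε x (t + τ) + (c - b * Real.log ((t + τ) / τ))| ≤ C * (1 + |x|) := by
  have hcont : ContinuousOn (fun t => coleHopf g ε 0 (t + τ) + (c - b * Real.log ((t + τ) / τ)))
      (Set.Icc 0 T) :=
    (isSmoothTest_coleHopf hg hε hτ b c).continuousOn.comp (f := fun t : ℝ => ((0 : ℝ), t))
      (by fun_prop) fun t ht => ⟨trivial, ht.1⟩
  obtain ⟨M, hM⟩ := isCompact_Icc.exists_bound_of_continuousOn hcont
  refine ⟨|M| + K, fun x t ht => ?_⟩
  have h1 := hM t ht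
  rw [Real.norm_eq_abs] at h1
  have ht0 : 0 < t + τ := by linarith [ht.1]
  have h2 := coleHopf_le_add hg hε ht0 x 0
  have h3 := coleHopf_le_add hg hε ht0 0 x
  rw [sub_zero] at h2
  rw [zero_sub, abs_neg] at h3
  have h4 := abs_le.1 (h1.trans (le_abs_self M))
  have h5 : 0 ≤ |M| * |x| := by positivity
  have h6 : (0 : ℝ) ≤ K := K.2
  rw [abs_le]
  constructor <;> nlinarith [h4.1, h4.2]

theorem tendsto_coleHopf_add (hg : LipschitzWith K g) (hε : 0 < ε) (x : ℝ) {t : ℝ} (ht : 0 < t) :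
    Tendsto (fun τ => coleHopf g ε x (t + τ)) (𝓝[>] 0) (𝓝 (coleHopf g ε x t)) := by
  have h := (hasDerivAt_coleHopf_time hg hε x ht).continuousAt.tendsto
  have h2 : Tendsto (fun τ : ℝ => t + τ) (𝓝[>] 0) (𝓝 t) := by
    have : Continuous fun τ : ℝ => t + τ := by fun_prop
    simpa using (this.tendsto 0).mono_left nhdsWithin_le_nhds
  exact h.comp h2

/-- The viscosity solution of the viscous equation is given by the Cole–Hopf formula. -/
theorem IsViscositySolution.eq_coleHopf (hg : LipschitzWith K g) (hε : 0 < ε) {u : ℝ → ℝ → ℝ}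
    (hu : IsViscositySolution (fun p => p ^ 2 / 2) ε g u) (x : ℝ) {t : ℝ} (ht : 0 < t) :
    u x t = coleHopf g ε x t := by
  have hpde : ∀ τ : ℝ, 0 < τ → ∀ y s : ℝ, 0 < s → _ := fun τ hτ y s hs =>
    coleHopf_equation (g := g) hε y (show 0 < s + τ by positivity)
  refine le_antisymm ?_ ?_
  -- The shift by `τ` plus `κ` is smooth up to `t = 0` and starts above `g`. Send `τ → 0` at fixed
  -- `κ`, `κ` being arbitrary.
  · refine le_of_forall_pos_le_add fun κ hκ => ?_
    refine ge_of_tendsto ((tendsto_coleHopf_add hg hε x ht).add_const κ) ?_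
    filter_upwards [self_mem_nhdsWithin, eventually_abs_coleHopf_sub_le hg hε hκ] with τ hτ hτκ
    have hτ : 0 < τ := hτ
    have h := (isSmoothTest_coleHopf hg hε hτ 0 κ).subsolution_le hε.le hu.continuousOn
      hu.subsolution (fun y s hs => by rw [← hpde τ hτ y s hs]; simp)
      (fun y => by
        have := (abs_le.1 (hτκ y)).1
        simp only [hu.initial, zero_add, zero_mul, sub_zero]
        linarith)
      (fun T hT => by
        obtain ⟨C₁, h₁⟩ := hu.linear_growth T hT
        obtain ⟨C₂, h₂⟩ := exists_abs_shifted_coleHopf_le hg hε hτ 0 κ T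
        refine ⟨C₁ + C₂, fun y s hs => ?_⟩
        rw [add_mul]
        linarith [(abs_le.1 (h₁ y s hs)).2, (abs_le.1 (h₂ y s hs)).1])
      x t ht.le
    simpa using h
  · refine le_of_forall_pos_le_add fun κ hκ => ?_
    rw [← sub_le_iff_le_add, sub_eq_add_neg]
    refine le_of_tendsto ((tendsto_coleHopf_add hg hε x ht).add_const (-κ)) ?_
    filter_upwards [self_mem_nhdsWithin, eventually_abs_coleHopf_sub_le hg hε hκ] with τ hτ hτκ
    have hτ : 0 < τ := hτ
    have h := (isSmoothTest_coleHopf hg hε hτ 0 (-κ)).le_supersolution hε.le hu.continuousOn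
      hu.supersolution (fun y s hs => by rw [← hpde τ hτ y s hs]; simp)
      (fun y => by
        have := (abs_le.1 (hτκ y)).2
        simp only [hu.initial, zero_add, zero_mul, sub_zero]
        linarith)
      (fun T hT => by
        obtain ⟨C₁, h₁⟩ := hu.linear_growth T hT
        obtain ⟨C₂, h₂⟩ := exists_abs_shifted_coleHopf_le hg hε hτ 0 (-κ) T
        refine ⟨C₁ + C₂, fun y s hs => ?_⟩
        rw [add_mul]
        linarith [(abs_le.1 (h₁ y s hs)).1, (abs_le.1 (h₂ y s hs)).2])
      x t ht.le
    simpa using h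

end ShiftedColeHopf

/-! ### The Hopf–Lax formula and the `ε |log ε|` bounds. -/

section HopfLax

variable {g : ℝ → ℝ} {K : ℝ≥0}

theorem abs_sub_le_of_lipschitz (hg : LipschitzWith K g) (x y : ℝ) :
    |g x - g y| ≤ K * |x - y| := by
  simpa [Real.dist_eq] using hg.dist_le_mul x y

theorem continuous_hopfLaxCost (hg : Continuous g) (x t : ℝ) : Continuous (hopfLaxCost g x t) := by
  unfold hopfLaxCost; fun_prop

theorem hopfLaxCost_self (x t : ℝ) : hopfLaxCost g x t x = g x := by simp [hopfLaxCost]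

/-- Beyond distance `2Kt` from `x` the quadratic term outweighs any decrease of `g`, so such points
cost at least as much as `y = x`; a minimizer over a compact interval is global. -/
theorem exists_forall_hopfLaxCost_le (hg : LipschitzWith K g) (x : ℝ) {t : ℝ} (ht : 0 < t) :
    ∃ y₀, ∀ y, hopfLaxCost g x t y₀ ≤ hopfLaxCost g x t y := by
  have h0 : 0 ≤ K * t := mul_nonneg K.2 ht.le
  obtain ⟨y₀, hy₀, hmin⟩ := (isCompact_Icc (a := x - 2 * K * t) (b := x + 2 * K * t)).exists_isMinOn
    ⟨x, by constructor <;> nlinarith⟩ (continuous_hopfLaxCost hg.continuous x t).continuousOn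
  refine ⟨y₀, fun y => ?_⟩
  by_cases hy : y ∈ Set.Icc (x - 2 * K * t) (x + 2 * K * t)
  · exact hmin hy
  · have h1 : hopfLaxCost g x t y₀ ≤ g x := by
      rw [← hopfLaxCost_self (g := g) x t]
      exact hmin (show x ∈ Set.Icc _ _ by constructor <;> nlinarith)
    have h2 : 2 * K * t < |x - y| := by
      by_contra! h
      exact hy ⟨by linarith [(abs_le.1 h).2], by linarith [(abs_le.1 h).1]⟩
    have h3 := (abs_le.1 (abs_sub_le_of_lipschitz hg x y)).2
    have h4 : K * |x - y| ≤ (x - y) ^ 2 / (2 * t) := by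
      rw [le_div_iff₀ (by positivity), ← sq_abs (x - y)]
      nlinarith [abs_nonneg (x - y)]
    simp only [hopfLaxCost] at h1 ⊢
    linarith

theorem abs_sub_le_of_isMin (hg : LipschitzWith K g) {x t y₀ : ℝ} (ht : 0 < t)
    (hy₀ : ∀ y, hopfLaxCost g x t y₀ ≤ hopfLaxCost g x t y) : |x - y₀| ≤ 2 * K * t := by
  have h1 := hy₀ x
  rw [hopfLaxCost_self, hopfLaxCost] at h1
  have h3 := (abs_le.1 (abs_sub_le_of_lipschitz hg x y₀)).2
  have h4 : (x - y₀) ^ 2 / (2 * t) ≤ K * |x - y₀| := by linarith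
  rw [div_le_iff₀ (by positivity), ← sq_abs (x - y₀)] at h4
  by_contra! h
  have h0 : 0 ≤ K * t := mul_nonneg K.2 ht.le
  nlinarith [abs_nonneg (x - y₀)]

/-- The restriction `r ≤ 1` makes the quadratic increment linear in `r`, which is what the Laplace
bound with `r = ε` needs. -/
theorem hopfLaxCost_le_add (hg : LipschitzWith K g) {t : ℝ} (ht : 0 < t) (x y₀ : ℝ) {r : ℝ}
    (hr : 0 ≤ r) (hr1 : r ≤ 1) : ∀ y ∈ Set.Icc (y₀ - r) (y₀ + r),
    hopfLaxCost g x t y ≤ hopfLaxCost g x t y₀ + ((2 * |x - y₀| + 1) / (2 * t) + K) * r := by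
  intro y hy
  have h1 : |y - y₀| ≤ r := abs_le.2 ⟨by linarith [hy.1], by linarith [hy.2]⟩
  have h2 := (abs_le.1 (abs_sub_le_of_lipschitz hg y y₀)).2
  have h3 : (K : ℝ) * |y - y₀| ≤ K * r := by gcongr
  have h4 : (x - y) ^ 2 - (x - y₀) ^ 2 ≤ (2 * |x - y₀| + 1) * r := by
    have e : (x - y) ^ 2 - (x - y₀) ^ 2 = -2 * (x - y₀) * (y - y₀) + |y - y₀| ^ 2 := by
      rw [sq_abs]; ring
    have h5 : -2 * (x - y₀) * (y - y₀) ≤ 2 * |x - y₀| * r := by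
      refine (le_abs_self _).trans ?_
      rw [abs_mul, abs_mul]
      norm_num
      gcongr
    have h6 : |y - y₀| ^ 2 ≤ r := by nlinarith [abs_nonneg (y - y₀)]
    rw [e]; linarith
  have h5 : ((x - y) ^ 2 - (x - y₀) ^ 2) / (2 * t) ≤ (2 * |x - y₀| + 1) * r / (2 * t) := by
    gcongr
  have h6 : hopfLaxCost g x t y - hopfLaxCost g x t y₀ =
    ((x - y) ^ 2 - (x - y₀) ^ 2) / (2 * t) + (g y - g y₀) := by simp only [hopfLaxCost]; ring
  have h7 : ((2 * |x - y₀| + 1) / (2 * t) + K) * r = (2 * |x - y₀| + 1) * r / (2 * t) + K * r := by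
    ring
  linarith

/-- Upper bound of order `ε |log ε|` for the Cole–Hopf formula. -/
theorem coleHopf_le_hopfLaxCost (hg : LipschitzWith K g) {ε : ℝ} (hε : 0 < ε) (hε1 : ε ≤ 1)
    (x y₀ : ℝ) {t : ℝ} (ht : 0 < t) :
    coleHopf g ε x t ≤ hopfLaxCost g x t y₀ +
      ε * ((2 * |x - y₀| + 1) / (2 * t) + K + Real.log (Real.pi * t)) - ε * Real.log ε := by
  have h := coleHopf_le_of_le hg hε ht hε (hopfLaxCost_le_add hg ht x y₀ hε.le hε1)
  have hpi := Real.pi_pos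
  have hlog : Real.log (Real.pi * ε * t / ε ^ 2) = Real.log (Real.pi * t) - Real.log ε := by
    rw [← Real.log_div (by positivity) hε.ne']
    congr 1
    field_simp
  rw [hlog] at h
  linarith

theorem integrable_exp_neg_hopfLaxCost_sub (hg : LipschitzWith K g) {ε : ℝ} (hε : 0 < ε) (x m : ℝ)
    {t : ℝ} (ht : 0 < t) :
    Integrable fun y => Real.exp (-(hopfLaxCost g x t y - m) / (2 * ε)) := by
  refine ((integrable_exp_neg_hopfLaxCost hg hε x ht).const_mul (Real.exp (m / (2 * ε)))).congr
    (ae_of_all _ fun y => ?_)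
  simp only
  rw [← Real.exp_add]
  congr 1
  ring

/-- Lower bound of order `ε |log ε|` for the Cole–Hopf formula. -/
theorem exists_le_coleHopf (hg : LipschitzWith K g) {x t y₀ : ℝ} (ht : 0 < t)
    (hy₀ : ∀ y, hopfLaxCost g x t y₀ ≤ hopfLaxCost g x t y) :
    ∃ C, ∀ ε ∈ Set.Ioo (0 : ℝ) 1,
      hopfLaxCost g x t y₀ - C * ε + ε * Real.log ε ≤ coleHopf g ε x t := by
  set m := hopfLaxCost g x t y₀
  -- Since the exponent is nonpositive, the integrand increases with `ε`, so its integral at `ε = 1`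
  -- serves for all smaller `ε`.
  set J := ∫ y, Real.exp (-(hopfLaxCost g x t y - m) / (2 * 1))
  refine ⟨2 * Real.log J - Real.log (4 * Real.pi * t), fun ε hε => ?_⟩
  have hε0 := hε.1
  have h := le_coleHopf_of_integral_le hg hε.1 ht (m := m) (J := J) (by
    refine integral_mono (integrable_exp_neg_hopfLaxCost_sub hg hε.1 x m ht)
      (integrable_exp_neg_hopfLaxCost_sub hg one_pos x m ht) fun y => ?_
    simp only [neg_div]
    have := sub_nonneg.2 (hy₀ y)
    gcongr
    exact hε.2.le)
  have hpi := Real.pi_pos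
  have hlog : Real.log (4 * Real.pi * ε * t) = Real.log (4 * Real.pi * t) + Real.log ε := by
    rw [← Real.log_mul (by positivity) hε.1.ne']
    congr 1
    ring
  rw [hlog] at h
  linarith

/-- A viscosity solution of the inviscid equation lies below the Hopf–Lax formula. -/
theorem IsViscositySolution.le_hopfLaxCost (hg : LipschitzWith K g) {u : ℝ → ℝ → ℝ}
    (hu : IsViscositySolution (fun p => p ^ 2 / 2) 0 g u) (x y : ℝ) {t : ℝ} (ht : 0 < t) :
    u x t ≤ hopfLaxCost g x t y := by
  -- The shift `δ` makes the parabola solution smooth at `t = 0`. Adding `K² δ / 2`, the maximum of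
  -- `K d - d² / (2δ)`, places it above `g` there. Its gradient is unbounded, whence the linear
  -- growth allowed in `IsSmoothTest`.
  have hlim : Tendsto (fun δ : ℝ => (x - y) ^ 2 / (2 * (t + δ)) + (g y + K ^ 2 * δ / 2))
      (𝓝[>] 0) (𝓝 (hopfLaxCost g x t y)) := by
    have : ContinuousAt (fun δ : ℝ => (x - y) ^ 2 / (2 * (t + δ)) + (g y + K ^ 2 * δ / 2)) 0 :=
      (ContinuousAt.div (by fun_prop) (by fun_prop) (by simp; positivity)).add (by fun_prop)
    have h := this.tendsto.mono_left (nhdsWithin_le_nhds (s := Set.Ioi 0))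
    simpa [hopfLaxCost] using h
  refine ge_of_tendsto hlim ?_
  filter_upwards [self_mem_nhdsWithin] with δ hδ
  have hδ : 0 < δ := hδ
  have htest : IsSmoothTest (fun x t => (x - y) ^ 2 / (2 * (t + δ)) + (g y + K ^ 2 * δ / 2))
      (fun x t => -((x - y) ^ 2 / (2 * (t + δ) ^ 2))) (fun x t => (x - y) / (t + δ))
      (fun _ t => 1 / (t + δ)) ((1 + |y|) / δ) := by
    have hcd : ∀ x t : ℝ, 0 ≤ t → ContDiffAt ℝ 2 (fun z : ℝ × ℝ =>
        (z.1 - y) ^ 2 / (2 * (z.2 + δ)) + (g y + K ^ 2 * δ / 2)) (x, t) := fun x t ht =>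
      (ContDiffAt.div (by fun_prop) (by fun_prop) (by simp only; positivity)).add contDiffAt_const
    refine ⟨fun z hz => (hcd z.1 z.2 hz.2).continuousAt.continuousWithinAt,
      fun x t ht => hcd x t ht.le, fun x t ht => ?_, fun x t ht => ?_, fun x t ht => ?_,
      fun x t ht => ?_⟩
    · have h1 : HasDerivAt (fun s => 2 * (s + δ)) 2 t := by
        simpa using ((hasDerivAt_id t).add_const δ).const_mul 2
      refine (((hasDerivAt_const t ((x - y) ^ 2)).div h1 (by positivity)).add_const _).congr_deriv ?_
      field_simp
      ring
    · have h1 : HasDerivAt (fun x => (x - y) ^ 2) (2 * (x - y)) x := by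
        exact (((hasDerivAt_id x).sub_const y).pow 2).congr_deriv (by simp)
      refine ((h1.div_const _).add_const _).congr_deriv ?_
      field_simp
    · exact ((hasDerivAt_id x).sub_const y).div_const _
    · rw [abs_div, abs_of_pos (show 0 < t + δ by positivity), div_mul_eq_mul_div]
      have h1 : |x - y| ≤ (1 + |y|) * (1 + |x|) := by
        have := abs_sub x y
        nlinarith [abs_nonneg x, abs_nonneg y]
      gcongr
      linarith
  refine htest.subsolution_le le_rfl hu.continuousOn hu.subsolution (fun x t ht => ?_) (fun x => ?_)
    (fun T hT => ?_) x t ht.le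
  · refine le_of_eq ?_
    field_simp
    ring
  · rw [hu.initial, zero_add]
    have h1 := (abs_le.1 (abs_sub_le_of_lipschitz hg x y)).2
    have h2 : K * |x - y| ≤ (x - y) ^ 2 / (2 * δ) + K ^ 2 * δ / 2 := by
      have : (x - y) ^ 2 / (2 * δ) + K ^ 2 * δ / 2 - K * |x - y| =
          (|x - y| - K * δ) ^ 2 / (2 * δ) := by
        rw [← sq_abs]; field_simp; ring
      have h3 : 0 ≤ (|x - y| - K * δ) ^ 2 / (2 * δ) := by positivity
      linarith
    linarith
  · obtain ⟨C, hC⟩ := hu.linear_growth T hT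
    refine ⟨C + |g y|, fun x t ht => ?_⟩
    have ht0 := ht.1
    have h1 := (abs_le.1 (hC x t ht)).2
    have h2 : 0 ≤ (x - y) ^ 2 / (2 * (t + δ)) + K ^ 2 * δ / 2 := by positivity
    have h3 : 0 ≤ |g y| * |x| := by positivity
    nlinarith [neg_abs_le (g y)]

/-- A viscosity solution of the inviscid equation lies above the Cole–Hopf formula, up to an
explicit error. -/
theorem IsViscositySolution.coleHopf_le (hg : LipschitzWith K g) {u : ℝ → ℝ → ℝ}
    (hu : IsViscositySolution (fun p => p ^ 2 / 2) 0 g u) {ε τ : ℝ} (hε : 0 < ε) (hε1 : ε ≤ 1)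
    (hτ : 0 < τ) (x : ℝ) {t : ℝ} (ht : 0 < t) :
    coleHopf g ε x (t + τ) - (ε * (1 / (2 * τ) + K + Real.log (Real.pi * τ)) - ε * Real.log ε) -
      ε * Real.log ((t + τ) / τ) ≤ u x t := by
  -- Subtracting `c` brings Cole–Hopf at time `τ` below `g`. The coefficient `ε` of the logarithm
  -- subtracts `ε / (s + τ)` from the time derivative, cancelling the semiconcavity bound on the
  -- viscous term.
  set c := ε * (1 / (2 * τ) + K + Real.log (Real.pi * τ)) - ε * Real.log ε with hc
  have h := (isSmoothTest_coleHopf hg hε hτ ε (-c)).le_supersolution le_rfl hu.continuousOn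
      hu.supersolution (fun y s hs => by
        have h0 : 0 < s + τ := by positivity
        have h1 := coleHopf_equation (g := g) hε y h0
        have h2 := mul_le_mul_of_nonneg_left (coleHopf_semiconcave hg hε y h0) hε.le
        have h3 : ε * (1 / (s + τ)) = ε / (s + τ) := by ring
        rw [h3] at h2
        rw [zero_mul]
        linarith)
      (fun y => by
        have := coleHopf_le_hopfLaxCost hg hε hε1 y y hτ
        rw [hopfLaxCost_self, sub_self, abs_zero, mul_zero, zero_add] at this
        rw [hu.initial]
        simp only [zero_add, div_self hτ.ne', Real.log_one, mul_zero, sub_zero]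
        linarith)
      (fun T hT => by
        obtain ⟨C₁, h₁⟩ := hu.linear_growth T hT
        obtain ⟨C₂, h₂⟩ := exists_abs_shifted_coleHopf_le hg hε hτ ε (-c) T
        refine ⟨C₁ + C₂, fun y s hs => ?_⟩
        rw [add_mul]
        linarith [(abs_le.1 (h₁ y s hs)).1, (abs_le.1 (h₂ y s hs)).2])
      x t ht.le
  linarith

theorem tendsto_mul_log_nhdsGT_zero : Tendsto (fun ε : ℝ => ε * Real.log ε) (𝓝[>] 0) (𝓝 0) := by
  have := Real.continuous_mul_log.tendsto 0
  simp only [zero_mul] at this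
  exact this.mono_left nhdsWithin_le_nhds

/-- A viscosity solution of the inviscid equation is given by the Hopf–Lax formula. -/
theorem IsViscositySolution.eq_hopfLaxCost (hg : LipschitzWith K g) {u : ℝ → ℝ → ℝ}
    (hu : IsViscositySolution (fun p => p ^ 2 / 2) 0 g u) {x t y₀ : ℝ} (ht : 0 < t)
    (hy₀ : ∀ y, hopfLaxCost g x t y₀ ≤ hopfLaxCost g x t y) :
    u x t = hopfLaxCost g x t y₀ := by
  refine le_antisymm (hu.le_hopfLaxCost hg x y₀ ht) ?_
  have hid : Tendsto (fun ε : ℝ => ε) (𝓝[>] 0) (𝓝 0) := nhdsWithin_le_nhds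
  have key : ∀ τ : ℝ, 0 < τ → ∀ y₁, (∀ y, hopfLaxCost g x (t + τ) y₁ ≤ hopfLaxCost g x (t + τ) y) →
      hopfLaxCost g x (t + τ) y₁ ≤ u x t := by
    intro τ hτ y₁ hy₁
    obtain ⟨C, hC⟩ := exists_le_coleHopf hg (show 0 < t + τ by positivity) hy₁
    have hlim : Tendsto (fun ε : ℝ => hopfLaxCost g x (t + τ) y₁ - C * ε + ε * Real.log ε -
        (ε * (1 / (2 * τ) + K + Real.log (Real.pi * τ)) - ε * Real.log ε) -
        ε * Real.log ((t + τ) / τ)) (𝓝[>] 0) (𝓝 (hopfLaxCost g x (t + τ) y₁)) := by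
      have := ((((tendsto_const_nhds (x := hopfLaxCost g x (t + τ) y₁)).sub
        (hid.const_mul C)).add tendsto_mul_log_nhdsGT_zero).sub
        ((hid.mul_const (1 / (2 * τ) + K + Real.log (Real.pi * τ))).sub
        tendsto_mul_log_nhdsGT_zero)).sub (hid.mul_const (Real.log ((t + τ) / τ)))
      simpa using this
    refine le_of_tendsto hlim ?_
    filter_upwards [Ioo_mem_nhdsGT one_pos] with ε hε
    linarith [hC ε hε, hu.coleHopf_le hg hε.1 hε.2.le hτ x ht]
  -- With `ε → 0` done at fixed `τ`, it remains to replace `t + τ` by `t`. Minimizers stay within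
  -- `2K(t + τ)` of `x`, so the cost changes by an amount that vanishes with `τ`.
  have hlim : Tendsto (fun τ : ℝ => hopfLaxCost g x t y₀ -
      (2 * K * (t + τ)) ^ 2 / 2 * (1 / t - 1 / (t + τ))) (𝓝[>] 0) (𝓝 (hopfLaxCost g x t y₀)) := by
    have : ContinuousAt (fun τ : ℝ => hopfLaxCost g x t y₀ -
        (2 * K * (t + τ)) ^ 2 / 2 * (1 / t - 1 / (t + τ))) 0 := by
      have h1 : ContinuousAt (fun τ : ℝ => 1 / (t + τ)) 0 :=
        ContinuousAt.div (by fun_prop) (by fun_prop) (by simp; positivity)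
      fun_prop
    have h := this.tendsto.mono_left (nhdsWithin_le_nhds (s := Set.Ioi 0))
    simpa using h
  refine le_of_tendsto hlim ?_
  filter_upwards [self_mem_nhdsWithin] with τ hτ
  have hτ : 0 < τ := hτ
  have h0 : 0 < t + τ := by positivity
  obtain ⟨y₁, hy₁⟩ := exists_forall_hopfLaxCost_le hg x h0
  refine le_trans ?_ (key τ hτ y₁ hy₁)
  have h1 : hopfLaxCost g x (t + τ) y₁ =
      hopfLaxCost g x t y₁ - |x - y₁| ^ 2 / 2 * (1 / t - 1 / (t + τ)) := by
    rw [sq_abs]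
    simp only [hopfLaxCost]
    field_simp
    ring
  rw [h1]
  have h2 : 0 ≤ 1 / t - 1 / (t + τ) := by
    rw [sub_nonneg]
    gcongr
    linarith
  have h3 := abs_sub_le_of_isMin hg h0 hy₁
  have h4 : |x - y₁| ^ 2 / 2 * (1 / t - 1 / (t + τ)) ≤
      (2 * K * (t + τ)) ^ 2 / 2 * (1 / t - 1 / (t + τ)) := by gcongr
  linarith [hy₀ y₁]

end HopfLax

/-! ### Nondegenerate minimizers and the `O(ε)` bounds. -/

/-- Second-order Taylor expansion with Peano remainder at a critical point. -/
theorem eventually_abs_sub_sub_sq_le {f f' : ℝ → ℝ} {d y₀ : ℝ} (hf : ∀ y, HasDerivAt f (f' y) y)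
    (hf' : HasDerivAt f' d y₀) (h0 : f' y₀ = 0) {η : ℝ} (hη : 0 < η) :
    ∀ᶠ y in 𝓝 y₀, |f y - f y₀ - d / 2 * (y - y₀) ^ 2| ≤ η * (y - y₀) ^ 2 := by
  have h1 := hf'.isLittleO.def hη
  obtain ⟨ρ, hρ, hball⟩ := Metric.eventually_nhds_iff.1 h1
  filter_upwards [Metric.ball_mem_nhds y₀ hρ] with y hy
  -- The mean value inequality is applied to the Taylor remainder, whose derivative is at most `η |y
  -- - y₀|` on this ball; no continuity of the second derivative is needed.
  have hderiv : ∀ z ∈ Metric.closedBall y₀ (dist y y₀),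
      HasDerivWithinAt (fun z => f z - f y₀ - d / 2 * (z - y₀) ^ 2) (f' z - d * (z - y₀))
        (Metric.closedBall y₀ (dist y y₀)) z := by
    intro z _
    have h2 : HasDerivAt (fun z : ℝ => d / 2 * (z - y₀) ^ 2) (d * (z - y₀)) z :=
      ((((hasDerivAt_id z).sub_const y₀).pow 2).const_mul (d / 2)).congr_deriv (by simp; ring)
    exact (((hf z).sub_const _).sub h2).hasDerivWithinAt
  have hbound : ∀ z ∈ Metric.closedBall y₀ (dist y y₀), ‖f' z - d * (z - y₀)‖ ≤ η * |y - y₀| := by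
    intro z hz
    have hz' : dist z y₀ ≤ dist y y₀ := hz
    have h3 := hball (hz'.trans_lt hy)
    rw [h0, sub_zero, smul_eq_mul, mul_comm _ d] at h3
    refine h3.trans ?_
    gcongr
    simpa [Real.dist_eq] using hz'
  have h4 := (convex_closedBall y₀ (dist y y₀)).norm_image_sub_le_of_norm_hasDerivWithin_le hderiv
    hbound (Metric.mem_closedBall_self dist_nonneg) (Metric.mem_closedBall.2 le_rfl)
  simpa [mul_assoc, ← sq] using h4

section Nondegenerate

variable {g : ℝ → ℝ} {K : ℝ≥0}

theorem hasDerivAt_hopfLaxCost (hg : Differentiable ℝ g) (x : ℝ) {t : ℝ} (ht : 0 < t) (y : ℝ) :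
    HasDerivAt (hopfLaxCost g x t) ((y - x) / t + deriv g y) y := by
  have h1 : HasDerivAt (fun y => (x - y) ^ 2 / (2 * t)) ((y - x) / t) y := by
    refine ((((hasDerivAt_id y).const_sub x).pow 2).div_const (2 * t)).congr_deriv ?_
    simp only [id]
    field_simp
    norm_num
    ring
  exact h1.add (hg y).hasDerivAt

theorem hasDerivAt_deriv_hopfLaxCost (hg : Differentiable ℝ (deriv g)) (x t y : ℝ) :
    HasDerivAt (fun y => (y - x) / t + deriv g y) (1 / t + deriv (deriv g) y) y :=
  (((hasDerivAt_id y).sub_const x).div_const t).add (hg y).hasDerivAt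

theorem deriv_eq_zero_of_isMin (hg : Differentiable ℝ g) {x t y₀ : ℝ} (ht : 0 < t)
    (hy₀ : ∀ y, hopfLaxCost g x t y₀ ≤ hopfLaxCost g x t y) : (y₀ - x) / t + deriv g y₀ = 0 :=
  IsLocalMin.hasDerivAt_eq_zero (Eventually.of_forall hy₀) (hasDerivAt_hopfLaxCost hg x ht y₀)

/-- Upper bound of order `ε` for the Cole–Hopf formula with `C²` data. -/
theorem exists_coleHopf_le_of_contDiff (hg : LipschitzWith K g) (hg2 : ContDiff ℝ 2 g) {x t y₀ : ℝ}
    (ht : 0 < t) (hy₀ : ∀ y, hopfLaxCost g x t y₀ ≤ hopfLaxCost g x t y) :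
    ∃ C, ∀ ε ∈ Set.Ioo (0 : ℝ) 1, coleHopf g ε x t ≤ hopfLaxCost g x t y₀ + C * ε := by
  have hd1 : Differentiable ℝ g := hg2.differentiable (by norm_num)
  have hd2 : Differentiable ℝ (deriv g) := hg2.differentiable_deriv_two
  have h := eventually_abs_sub_sub_sq_le (hasDerivAt_hopfLaxCost hd1 x ht)
    (hasDerivAt_deriv_hopfLaxCost hd2 x t y₀) (deriv_eq_zero_of_isMin hd1 ht hy₀) one_pos
  set d := 1 / t + deriv (deriv g) y₀
  obtain ⟨ρ, hρ, hball⟩ := Metric.nhds_basis_closedBall.eventually_iff.1 h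
  refine ⟨(|d| / 2 + 1) * ρ ^ 2 + Real.log (Real.pi * t / ρ ^ 2), fun ε hε => ?_⟩
  have hε0 := hε.1
  have hs : 0 < √ε := Real.sqrt_pos.2 hε.1
  have hs1 : √ε ≤ 1 := Real.sqrt_le_one.2 hε.2.le
  have hss : √ε ^ 2 = ε := Real.sq_sqrt hε.1.le
  -- At radius `ρ √ε` the cost rises only by `O(ε)` because `y₀` is critical, and `ε` cancels inside
  -- the logarithm.
  have h1 := coleHopf_le_of_le hg hε.1 ht (x := x) (y₀ := y₀) (r := ρ * √ε)
    (B := (|d| / 2 + 1) * ρ ^ 2 * ε) (by positivity) (fun y hy => by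
      have hr : |y - y₀| ≤ ρ * √ε := abs_le.2 ⟨by linarith [hy.1], by linarith [hy.2]⟩
      have h2 := (abs_le.1 (hball (show y ∈ Metric.closedBall y₀ ρ by
        rw [Metric.mem_closedBall, Real.dist_eq]
        exact hr.trans (mul_le_of_le_one_right hρ.le hs1)))).2
      have h3 : (y - y₀) ^ 2 ≤ ρ ^ 2 * ε := by
        rw [← hss, ← mul_pow, ← sq_abs]; gcongr
      have h4 : (d / 2 + 1) * (y - y₀) ^ 2 ≤ (|d| / 2 + 1) * (ρ ^ 2 * ε) := by
        gcongr; exact le_abs_self d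
      linarith)
  rw [mul_pow, hss, show Real.pi * ε * t / (ρ ^ 2 * ε) = Real.pi * t / ρ ^ 2 by field_simp] at h1
  linarith

/-- Minimality excludes a negative second derivative, so a nonzero one is positive; the Peano
remainder then uses up only half of the quadratic term. -/
theorem exists_mul_sq_le_of_isMin (hg2 : ContDiff ℝ 2 g) {x t y₀ : ℝ} (ht : 0 < t)
    (hy₀ : ∀ y, hopfLaxCost g x t y₀ ≤ hopfLaxCost g x t y)
    (hne : 1 / t + deriv (deriv g) y₀ ≠ 0) :
    ∃ c, 0 < c ∧ ∀ᶠ y in 𝓝 y₀, c * (y - y₀) ^ 2 ≤ hopfLaxCost g x t y - hopfLaxCost g x t y₀ := by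
  have hd1 : Differentiable ℝ g := hg2.differentiable (by norm_num)
  have hd2 : Differentiable ℝ (deriv g) := hg2.differentiable_deriv_two
  set d := 1 / t + deriv (deriv g) y₀
  have h := eventually_abs_sub_sub_sq_le (hasDerivAt_hopfLaxCost hd1 x ht)
    (hasDerivAt_deriv_hopfLaxCost hd2 x t y₀) (deriv_eq_zero_of_isMin hd1 ht hy₀)
    (show 0 < |d| / 4 by positivity)
  have hd : 0 < d := by
    by_contra! hd
    have hdneg : d < 0 := lt_of_le_of_ne hd hne
    obtain ⟨ρ, hρ, hball⟩ := Metric.nhds_basis_closedBall.eventually_iff.1 h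
    have h2 := (abs_le.1 (hball (show y₀ + ρ ∈ Metric.closedBall y₀ ρ by
      simp [abs_of_pos hρ]))).2
    have h3 := hy₀ (y₀ + ρ)
    rw [add_sub_cancel_left, abs_of_neg hdneg] at h2
    have : d * ρ ^ 2 < 0 := mul_neg_of_neg_of_pos hdneg (by positivity)
    nlinarith
  refine ⟨d / 4, by positivity, h.mono fun y hy => ?_⟩
  rw [abs_of_pos hd] at hy
  linarith [(abs_le.1 hy).1]

/-- The integrand lies below a Gaussian of width of order `√ε`. The centre `z` need not be a
minimizer, so this serves both local pieces and the tail. -/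
theorem exists_setIntegral_exp_le (hg : LipschitzWith K g) {x t m c z : ℝ} (ht : 0 < t)
    (hc : 0 < c) {s : Set ℝ} (hs : MeasurableSet s)
    (h : ∀ y ∈ s, c * (y - z) ^ 2 ≤ hopfLaxCost g x t y - m) :
    ∃ C, ∀ ε ∈ Set.Ioo (0 : ℝ) 1,
      ∫ y in s, Real.exp (-(hopfLaxCost g x t y - m) / (2 * ε)) ≤ C * √ε := by
  refine ⟨√(2 * Real.pi / c), fun ε hε => ?_⟩
  have hε0 := hε.1
  have hi : Integrable fun y : ℝ => Real.exp (-(c / (2 * ε)) * (y - z) ^ 2) :=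
    (integrable_exp_neg_mul_sq (show 0 < c / (2 * ε) by positivity)).comp_sub_right z
  calc ∫ y in s, Real.exp (-(hopfLaxCost g x t y - m) / (2 * ε))
      ≤ ∫ y in s, Real.exp (-(c / (2 * ε)) * (y - z) ^ 2) := by
        refine setIntegral_mono_on (integrable_exp_neg_hopfLaxCost_sub hg hε.1 x m ht).integrableOn
          hi.integrableOn hs fun y hy => ?_
        have e : -(c / (2 * ε)) * (y - z) ^ 2 = -(c * (y - z) ^ 2) / (2 * ε) := by ring
        rw [e]
        gcongr
        exact h y hy
    _ ≤ ∫ y, Real.exp (-(c / (2 * ε)) * (y - z) ^ 2) :=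
        setIntegral_le_integral hi (ae_of_all _ fun y => (Real.exp_pos _).le)
    _ = √(2 * Real.pi / c) * √ε := by
        rw [integral_sub_right_eq_self (fun y => Real.exp (-(c / (2 * ε)) * y ^ 2)),
          integral_gaussian, ← Real.sqrt_mul (by positivity)]
        congr 1
        field_simp

/-- If all minimizers are nondegenerate, the Laplace integral is of order `√ε`. -/
theorem exists_integral_exp_le_of_nondegenerate (hg : LipschitzWith K g) (hg2 : ContDiff ℝ 2 g)
    {x t y₀ : ℝ} (ht : 0 < t) (hy₀ : ∀ y, hopfLaxCost g x t y₀ ≤ hopfLaxCost g x t y)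
    (hreg : ∀ y₁, (∀ y, hopfLaxCost g x t y₁ ≤ hopfLaxCost g x t y) →
      1 / t + deriv (deriv g) y₁ ≠ 0) :
    ∃ C, ∀ ε ∈ Set.Ioo (0 : ℝ) 1,
      ∫ y, Real.exp (-(hopfLaxCost g x t y - hopfLaxCost g x t y₀) / (2 * ε)) ≤ C * √ε := by
  set m := hopfLaxCost g x t y₀
  have hint := fun ε (hε : 0 < ε) => integrable_exp_neg_hopfLaxCost_sub hg hε x m ht
  have hpos : ∀ (ε : ℝ) (μ : Measure ℝ),
      0 ≤ᵐ[μ] fun y => Real.exp (-(hopfLaxCost g x t y - m) / (2 * ε)) :=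
    fun ε μ => ae_of_all _ fun y => (Real.exp_pos _).le
  have hunion : ∀ (ε : ℝ), 0 < ε → ∀ s s' : Set ℝ,
      ∫ y in s ∪ s', Real.exp (-(hopfLaxCost g x t y - m) / (2 * ε)) ≤
      (∫ y in s, Real.exp (-(hopfLaxCost g x t y - m) / (2 * ε))) +
      ∫ y in s', Real.exp (-(hopfLaxCost g x t y - m) / (2 * ε)) := by
    intro ε hε s s'
    have hi := hint ε hε
    rw [← integral_add_measure hi.integrableOn hi.integrableOn]
    exact integral_mono_measure (Measure.restrict_union_le s s') (hpos ε _)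
      (Integrable.add_measure hi.restrict hi.restrict)
  -- Away from minimizers the cost gap is locally bounded below, hence trivially dominates a small
  -- multiple of `(y - z)² ≤ 1`. Every point thus has the same local bound.
  have hlocal : ∀ z, ∃ c, 0 < c ∧ ∀ᶠ y in 𝓝 z, c * (y - z) ^ 2 ≤ hopfLaxCost g x t y - m := by
    intro z
    rcases (hy₀ z).eq_or_lt with hz | hz
    · have hmin : ∀ y, hopfLaxCost g x t z ≤ hopfLaxCost g x t y := fun y => hz ▸ hy₀ y
      rw [hz]
      exact exists_mul_sq_le_of_isMin hg2 ht hmin (hreg z hmin)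
    · refine ⟨(hopfLaxCost g x t z - m) / 2, by linarith, ?_⟩
      have hcont := (continuous_hopfLaxCost hg.continuous x t).continuousAt (x := z)
      filter_upwards [Metric.ball_mem_nhds z one_pos,
        hcont.eventually (lt_mem_nhds (show (hopfLaxCost g x t z + m) / 2 < _ by linarith))]
        with y hy1 hy2
      have hy1 : |y - z| < 1 := hy1
      have h3 : (y - z) ^ 2 ≤ 1 := (sq_le_one_iff_abs_le_one _).2 hy1.le
      have h4 : (hopfLaxCost g x t z - m) / 2 * (y - z) ^ 2 ≤ (hopfLaxCost g x t z - m) / 2 :=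
        mul_le_of_le_one_right (by linarith) h3
      linarith
  -- Beyond this radius half of the quadratic term pays for the variation of `g`, and the other half
  -- gives the Gaussian tail.
  set R := 4 * K * t
  have hcompact : ∃ C, ∀ ε ∈ Set.Ioo (0 : ℝ) 1,
      ∫ y in Metric.closedBall x R, Real.exp (-(hopfLaxCost g x t y - m) / (2 * ε)) ≤ C * √ε := by
    -- The bound passes to subsets and finite unions, so compactness reduces it to small balls.
    refine (isCompact_closedBall x R).induction_on (p := fun s => ∃ C, ∀ ε ∈ Set.Ioo (0 : ℝ) 1,
      ∫ y in s, Real.exp (-(hopfLaxCost g x t y - m) / (2 * ε)) ≤ C * √ε) ⟨0, by simp⟩ ?_ ?_ ?_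
    · rintro s s' hss ⟨C, hC⟩
      exact ⟨C, fun ε hε => (setIntegral_mono_set (hint ε hε.1).integrableOn (hpos ε _)
        hss.eventuallyLE).trans (hC ε hε)⟩
    · rintro s s' ⟨C, hC⟩ ⟨C', hC'⟩
      refine ⟨C + C', fun ε hε => (hunion ε hε.1 s s').trans ?_⟩
      rw [add_mul]
      exact add_le_add (hC ε hε) (hC' ε hε)
    · intro z _
      obtain ⟨c, hc, hev⟩ := hlocal z
      obtain ⟨ρ, hρ, hball⟩ := Metric.nhds_basis_closedBall.eventually_iff.1 hev
      exact ⟨Metric.closedBall z ρ, mem_nhdsWithin_of_mem_nhds (Metric.closedBall_mem_nhds z hρ),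
        exists_setIntegral_exp_le hg ht hc measurableSet_closedBall fun y hy => hball hy⟩
  have htail : ∃ C, ∀ ε ∈ Set.Ioo (0 : ℝ) 1,
      ∫ y in (Metric.closedBall x R)ᶜ, Real.exp (-(hopfLaxCost g x t y - m) / (2 * ε)) ≤
        C * √ε := by
    refine exists_setIntegral_exp_le hg ht (c := 1 / (4 * t)) (z := x) (by positivity)
      measurableSet_closedBall.compl fun y hy => ?_
    have hy : R < |y - x| := by simpa [Real.dist_eq] using hy
    have h1 : m ≤ g x := by rw [← hopfLaxCost_self (g := g) x t]; exact hy₀ x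
    have h2 := (abs_le.1 (abs_sub_le_of_lipschitz hg y x)).1
    have h3 : K * |y - x| ≤ (y - x) ^ 2 / (4 * t) := by
      rw [le_div_iff₀ (by positivity), ← sq_abs (y - x)]
      nlinarith [abs_nonneg (y - x)]
    have h4 : hopfLaxCost g x t y = 2 * ((y - x) ^ 2 / (4 * t)) + g y := by
      simp only [hopfLaxCost]; field_simp; ring
    have h5 : 1 / (4 * t) * (y - x) ^ 2 = (y - x) ^ 2 / (4 * t) := by ring
    rw [h4, h5]
    linarith
  obtain ⟨C, hC⟩ := hcompact
  obtain ⟨C', hC'⟩ := htail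
  refine ⟨C + C', fun ε hε => ?_⟩
  rw [← integral_add_compl measurableSet_closedBall (hint ε hε.1), add_mul]
  exact add_le_add (hC ε hε) (hC' ε hε)

/-- Lower bound of order `ε` for the Cole–Hopf formula at points all of whose minimizers are
nondegenerate. -/
theorem exists_le_coleHopf_of_nondegenerate (hg : LipschitzWith K g) (hg2 : ContDiff ℝ 2 g)
    {x t y₀ : ℝ} (ht : 0 < t) (hy₀ : ∀ y, hopfLaxCost g x t y₀ ≤ hopfLaxCost g x t y)
    (hreg : ∀ y₁, (∀ y, hopfLaxCost g x t y₁ ≤ hopfLaxCost g x t y) →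
      1 / t + deriv (deriv g) y₁ ≠ 0) :
    ∃ C, ∀ ε ∈ Set.Ioo (0 : ℝ) 1, hopfLaxCost g x t y₀ - C * ε ≤ coleHopf g ε x t := by
  obtain ⟨C, hC⟩ := exists_integral_exp_le_of_nondegenerate hg hg2 ht hy₀ hreg
  refine ⟨2 * Real.log (|C| + 1) - Real.log (4 * Real.pi * t), fun ε hε => ?_⟩
  have hε0 := hε.1
  have hs : 0 < √ε := Real.sqrt_pos.2 hε.1
  have h := le_coleHopf_of_integral_le hg hε.1 ht (J := (|C| + 1) * √ε) ((hC ε hε).trans (by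
    gcongr; linarith [le_abs_self C]))
  have hpi := Real.pi_pos
  have hlog : Real.log (4 * Real.pi * ε * t) = Real.log (4 * Real.pi * t) + Real.log ε := by
    rw [← Real.log_mul (by positivity) hε.1.ne']
    congr 1
    ring
  rw [hlog, Real.log_mul (by positivity) hs.ne', Real.log_sqrt hε.1.le] at h
  linarith

/-- For almost every `x`, all minimizers in the Hopf–Lax formula are nondegenerate. -/
theorem ae_nondegenerate (hg2 : ContDiff ℝ 2 g) {t : ℝ} (ht : 0 < t) :
    ∀ᵐ x ∂(volume : Measure ℝ), ∀ y₁, (∀ y, hopfLaxCost g x t y₁ ≤ hopfLaxCost g x t y) →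
      1 / t + deriv (deriv g) y₁ ≠ 0 := by
  have hd1 : Differentiable ℝ g := hg2.differentiable (by norm_num)
  have hd2 : Differentiable ℝ (deriv g) := hg2.differentiable_deriv_two
  -- These are the critical points of `y ↦ y + t g'(y)`, so their image is null; stationarity of a
  -- minimizer `y₁` says `x = y₁ + t g'(y₁)`.
  set S := {y : ℝ | 1 / t + deriv (deriv g) y = 0} with hS
  have hnull : volume ((fun y => y + t * deriv g y) '' S) = 0 := by
    refine addHaar_image_eq_zero_of_det_fderivWithin_eq_zero volume
      (f' := fun y => (1 + t * deriv (deriv g) y) • ContinuousLinearMap.id ℝ ℝ) (fun y _ => ?_)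
      fun y hy => ?_
    · have h := (hasDerivAt_id y).add ((hd2 y).hasDerivAt.const_mul t)
      refine (h.hasFDerivAt.congr_fderiv ?_).hasFDerivWithinAt
      ext
      simp
    · have h : 1 / t + deriv (deriv g) y = 0 := hy
      have h0 : 1 + t * deriv (deriv g) y = 0 := by
        have : 1 + t * deriv (deriv g) y = t * (1 / t + deriv (deriv g) y) := by field_simp
        rw [this, h, mul_zero]
      simp [h0, ContinuousLinearMap.det]
  filter_upwards [compl_mem_ae_iff.2 hnull] with x hx y₁ hy₁ h0
  refine hx ⟨y₁, h0, ?_⟩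
  have h1 := deriv_eq_zero_of_isMin hd1 ht hy₁
  field_simp at h1
  simp only
  linarith

end Nondegenerate

/-! ### Assembly of the three claims. -/

theorem exists_forall_le_abs_log (M : ℝ) :
    ∃ ε₀ : ℝ, 0 < ε₀ ∧ ε₀ ≤ 1 ∧ ∀ ε ∈ Set.Ioo 0 ε₀, Real.log ε < 0 ∧ M ≤ -Real.log ε := by
  refine ⟨Real.exp (-|M|), Real.exp_pos _, Real.exp_le_one_iff.2 (by simp), fun ε hε => ?_⟩
  have h : Real.log ε < -|M| := (Real.log_lt_iff_lt_exp hε.1).2 hε.2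
  exact ⟨by linarith [abs_nonneg M], by linarith [le_abs_self M]⟩

theorem proposition4p4 (g : ℝ → ℝ) (K : ℝ≥0) (hg : LipschitzWith K g)
    (uε : ℝ → ℝ → ℝ → ℝ) (u : ℝ → ℝ → ℝ)
    (huε : ∀ ε ∈ Set.Ioo (0 : ℝ) 1, IsViscositySolution (fun p => p ^ 2 / 2) ε g (uε ε))
    (hu : IsViscositySolution (fun p => p ^ 2 / 2) 0 g u) :
    (∀ x t : ℝ, 0 ≤ t →
      ∃ ε₀ : ℝ, 0 < ε₀ ∧ ε₀ ≤ 1 ∧ ∀ ε ∈ Set.Ioo 0 ε₀,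
        |uε ε x t - u x t| ≤ 2 * ε * |Real.log ε|) ∧
    (ContDiff ℝ 2 g → ∀ t : ℝ, 0 < t →
      ∀ᵐ x ∂(volume : Measure ℝ), ∃ C : ℝ, 0 < C ∧ ∀ ε ∈ Set.Ioo (0 : ℝ) 1,
        |uε ε x t - u x t| ≤ C * ε) ∧
    ((∀ x ∈ Set.Icc (-1 : ℝ) 1, g x = -(x ^ 2 / 2)) → (∀ x : ℝ, -(x ^ 2 / 2) ≤ g x) →
      ∃ ε₀ : ℝ, 0 < ε₀ ∧ ε₀ ≤ 1 ∧ ∀ ε ∈ Set.Ioo 0 ε₀,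
        1 / 2 * ε * |Real.log ε| ≤ |uε ε 0 1 - u 0 1|) := by
  refine ⟨fun x t ht => ?_, fun hg2 t ht => ?_, fun hg1 hg2 => ?_⟩
  · rcases ht.eq_or_lt with rfl | ht
    · refine ⟨1, one_pos, le_rfl, fun ε hε => ?_⟩
      have := hε.1
      rw [(huε ε hε).initial, hu.initial, sub_self, abs_zero]
      positivity
    · obtain ⟨y₀, hy₀⟩ := exists_forall_hopfLaxCost_le hg x ht
      obtain ⟨C, hC⟩ := exists_le_coleHopf hg ht hy₀
      set C' := (2 * |x - y₀| + 1) / (2 * t) + K + Real.log (Real.pi * t)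
      -- Each one-sided error is `ε |log ε|` plus `Cε` or `C'ε`; this threshold turns the latter
      -- into a second `ε |log ε|`.
      obtain ⟨ε₀, hε₀, hε₀1, h⟩ := exists_forall_le_abs_log (max C C')
      refine ⟨ε₀, hε₀, hε₀1, fun ε hε => ?_⟩
      have hε1 : ε ∈ Set.Ioo (0 : ℝ) 1 := ⟨hε.1, hε.2.trans_le hε₀1⟩
      obtain ⟨hlog, hM⟩ := h ε hε
      have hl := hC ε hε1
      have hr := coleHopf_le_hopfLaxCost hg hε.1 hε1.2.le x y₀ ht
      have h1 : ε * C ≤ ε * -Real.log ε :=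
        mul_le_mul_of_nonneg_left ((le_max_left _ _).trans hM) hε.1.le
      have h2 : ε * C' ≤ ε * -Real.log ε :=
        mul_le_mul_of_nonneg_left ((le_max_right _ _).trans hM) hε.1.le
      rw [(huε ε hε1).eq_coleHopf hg hε.1 x ht, hu.eq_hopfLaxCost hg ht hy₀, abs_of_neg hlog, abs_le]
      constructor <;> linarith
  · filter_upwards [ae_nondegenerate hg2 ht] with x hx
    obtain ⟨y₀, hy₀⟩ := exists_forall_hopfLaxCost_le hg x ht
    obtain ⟨C, hC⟩ := exists_le_coleHopf_of_nondegenerate hg hg2 ht hy₀ hx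
    obtain ⟨C', hC'⟩ := exists_coleHopf_le_of_contDiff hg hg2 ht hy₀
    refine ⟨|C| + |C'| + 1, by positivity, fun ε hε => ?_⟩
    have h1 : C * ε ≤ |C| * ε := mul_le_mul_of_nonneg_right (le_abs_self C) hε.1.le
    have h2 : C' * ε ≤ |C'| * ε := mul_le_mul_of_nonneg_right (le_abs_self C') hε.1.le
    have h3 := mul_nonneg (abs_nonneg C) hε.1.le
    have h4 := mul_nonneg (abs_nonneg C') hε.1.le
    have hε0 := hε.1
    rw [(huε ε hε).eq_coleHopf hg hε.1 x ht, hu.eq_hopfLaxCost hg ht hy₀, abs_le]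
    constructor <;> linarith [hC ε hε, hC' ε hε]
  · have hcost0 : hopfLaxCost g 0 1 0 = 0 := by
      rw [hopfLaxCost_self, hg1 0 (by norm_num)]; norm_num
    have hmin : ∀ y, hopfLaxCost g 0 1 0 ≤ hopfLaxCost g 0 1 y := by
      intro y
      rw [hcost0, hopfLaxCost]
      linarith [hg2 y]
    -- The flat cost on `[-1, 1]` gives `uε ≤ ε log π + ε log ε` while `u = 0`; half of `|log ε|`
    -- must outweigh `log π`.
    obtain ⟨ε₀, hε₀, hε₀1, h⟩ := exists_forall_le_abs_log (2 * Real.log Real.pi)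
    refine ⟨ε₀, hε₀, hε₀1, fun ε hε => ?_⟩
    have hε0 := hε.1
    obtain ⟨hlog, hM⟩ := h ε hε
    have h1 := coleHopf_le_of_le hg hε.1 one_pos (x := 0) (y₀ := 0) (r := 1) (B := 0) one_pos
      (fun y hy => by
        rw [hcost0, hopfLaxCost, hg1 y (by simpa using hy)]
        apply le_of_eq
        ring)
    rw [hcost0, one_pow, div_one, mul_one, Real.log_mul Real.pi_pos.ne' hε.1.ne'] at h1
    rw [(huε ε ⟨hε.1, hε.2.trans_le hε₀1⟩).eq_coleHopf hg hε.1 0 one_pos,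
      hu.eq_hopfLaxCost hg one_pos hmin, hcost0, sub_zero, abs_of_neg hlog]
    refine le_trans ?_ (neg_le_abs _)
    have h2 : ε * (2 * Real.log Real.pi) ≤ ε * -Real.log ε :=
      mul_le_mul_of_nonneg_left hM hε.1.le
    linarith
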